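/- All manifolds, maps, metrics and fields are $C^\infty$, and manifolds have no boundary. Let $\bar M^{n+1}$ be a Riemannian manifold with Levi-Civita connection $\bar\nabla$, and let $X$ be a closed conformal vector field on $\bar M$ which is not identically zero; that is, $\bar\nabla_Y X=\phi\,Y$ for every vector field $Y$, for some smooth function $\phi$ on $\bar M$. Let $M^n$ be a hypersurface of $\bar M$ (possibly only immersed), with the induced metric and a smooth unit normal field $\xi$, and let $A_\xi Y=-\bar\nabla_Y\xi$ be its shape operator. Suppose that the tangent part $X^T=X-\langle X,\xi\rangle\xi$ vanishes nowhere on $M$, put $T=X^T/|X^T|$, and let $\theta\in(0,\pi)$ be the angle function on $M$ given by $\cos\theta=\langle X/|X|,\xi\rangle$. Then the following are equivalent: 1. $T$ is a principal direction of $M$, i.e. at every point of $M$, $A_\xi T=\lambda T$ for some $\lambda\in\mathbb R$. 2. $\theta$ is constant along the directions tangent to $M$ and orthogonal to $T$, i.e. $d\theta(v)=0$ for every $v\in TM$ with $\langle v,T\rangle=0$. In addition, let $W\subseteq\bar M$ be an open subset isometric to a warped product $I\times_\varrho N$ with metric $dt^2+\varrho(t)^2g_N$, where $I\subseteq\mathbb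 R$ is an open interval, $\varrho:I\to(0,\infty)$ is smooth and $N$ is an $n$-dimensional Riemannian manifold, by an isometry under which $X$ corresponds to $\varrho\,\partial_t$. Suppose that $\theta\neq\pi/2$ at all points of $M\cap W$, and let $h:M\cap W\to I$ be the height function, i.e. the restriction of the projection $I\times_\varrho N\to I$. Then statements 1 and 2 for $M\cap W$ are equivalent to each other and to each of the following: 3. The integral curves of $T$ in $M\cap W$ are geodesics of $M$. 4. $|\nabla h|$ (gradient and norm in $M$) is constant on each connected component of each level set of $h$. If, moreover, $M\cap W$ is the graph $\{(F(x),x): x\in U\}$ of a smooth function $F:U\to I$ on an open subset $U\subseteq N$, they are also equivalent to: 5. $|\nabla F|$ (gradient and norm in $N$) is constant on each connected component of each level set of $F$. -/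

import Mathlib

open Bundle Manifold Set
open scoped ContDiff Topology

noncomputable section

namespace Hypersurface

section LeviCivita

variable {E : Type*} [NormedAddCommGroup E] [NormedSpace ℝ E] [FiniteDimensional ℝ E]
  {H : Type*} [TopologicalSpace H] {I : ModelWithCorners ℝ E H}
  {M : Type*} [TopologicalSpace M] [ChartedSpace H M]

instance instFiniteDimensionalTangentSpace (x : M) : FiniteDimensional ℝ (TangentSpace I x) :=
  inferInstanceAs (FiniteDimensional ℝ E)

variable [IsManifold I ∞ M] [RiemannianBundle (fun x : M ↦ TangentSpace I x)]

variable (I) in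
/-- The right-hand side of the Koszul formula: this is `⟨∇_X Y, Z⟩` for the Levi-Civita
connection `∇`. -/
def koszul (X Y Z : Π x : M, TangentSpace I x) (x : M) : ℝ :=
  (mvfderiv I (fun y ↦ inner ℝ (Y y) (Z y)) x (X x)
    + mvfderiv I (fun y ↦ inner ℝ (X y) (Z y)) x (Y x)
    - mvfderiv I (fun y ↦ inner ℝ (X y) (Y y)) x (Z x)
    + inner ℝ (VectorField.mlieBracket I X Y x) (Z x)
    - inner ℝ (VectorField.mlieBracket I X Z x) (Y x)
    - inner ℝ (VectorField.mlieBracket I Y Z x) (X x)) / 2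

variable [IsContMDiffRiemannianBundle I ∞ E (fun x : M ↦ TangentSpace I x)]

set_option linter.unusedSectionVars false in
theorem mdifferentiableAt_inner {Y Z : Π x : M, TangentSpace I x} {x : M}
    (hY : MDiffAt (T% Y) x) (hZ : MDiffAt (T% Z) x) :
    MDifferentiableAt I 𝓘(ℝ, ℝ) (fun y ↦ inner ℝ (Y y) (Z y)) x :=
  MDifferentiableAt.inner_bundle (F := E) (E := fun x : M ↦ TangentSpace I x) hY hZ

theorem koszul_tensorial_left {Y Z : Π x : M, TangentSpace I x} {x : M}
    (hY : MDiffAt (T% Y) x) (hZ : MDiffAt (T% Z) x) :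
    TensorialAt I E (fun X ↦ koszul I X Y Z x) x where
  smul {g X} hg hX := by
    have h1 := mvfderiv_fun_mul hg (mdifferentiableAt_inner hX hZ)
    have h2 := mvfderiv_fun_mul hg (mdifferentiableAt_inner hX hY)
    simp [koszul, h1, h2, inner_smul_left, VectorField.mlieBracket_smul_left hg hX,
      inner_add_left, inner_smul_right]
    ring
  add {X X'} hX hX' := by
    have h1 := mvfderiv_fun_add (mdifferentiableAt_inner hX hZ) (mdifferentiableAt_inner hX' hZ)
    have h2 := mvfderiv_fun_add (mdifferentiableAt_inner hX hY) (mdifferentiableAt_inner hX' hY)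
    simp [koszul, h1, h2, inner_add_left, inner_add_right, VectorField.mlieBracket_add_left hX hX']
    ring

theorem koszul_tensorial_right {X Y : Π x : M, TangentSpace I x} {x : M}
    (hX : MDiffAt (T% X) x) (hY : MDiffAt (T% Y) x) :
    TensorialAt I E (fun Z ↦ koszul I X Y Z x) x where
  smul {g Z} hg hZ := by
    have h1 := mvfderiv_fun_mul hg (mdifferentiableAt_inner hX hZ)
    have h2 := mvfderiv_fun_mul hg (mdifferentiableAt_inner hY hZ)
    simp [koszul, h1, h2, inner_smul_left, inner_add_left,
      VectorField.mlieBracket_smul_right hg hZ, inner_smul_right]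
    rw [real_inner_comm (X x) (Z x), real_inner_comm (Y x) (Z x)]
    ring
  add {Z Z'} hZ hZ' := by
    have h1 := mvfderiv_fun_add (mdifferentiableAt_inner hX hZ) (mdifferentiableAt_inner hX hZ')
    have h2 := mvfderiv_fun_add (mdifferentiableAt_inner hY hZ) (mdifferentiableAt_inner hY hZ')
    simp [koszul, h1, h2, inner_add_left, inner_add_right, VectorField.mlieBracket_add_right hZ hZ']
    ring

theorem koszul_add {X Y Y' Z : Π x : M, TangentSpace I x} {x : M}
    (hX : MDiffAt (T% X) x) (hY : MDiffAt (T% Y) x) (hY' : MDiffAt (T% Y') x)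
    (hZ : MDiffAt (T% Z) x) :
    koszul I X (Y + Y') Z x = koszul I X Y Z x + koszul I X Y' Z x := by
  have h1 := mvfderiv_fun_add (mdifferentiableAt_inner hX hY) (mdifferentiableAt_inner hX hY')
  have h2 := mvfderiv_fun_add (mdifferentiableAt_inner hY hZ) (mdifferentiableAt_inner hY' hZ)
  simp [koszul, h1, h2, inner_add_left, inner_add_right, VectorField.mlieBracket_add_right hY hY',
    VectorField.mlieBracket_add_left hY hY']
  ring

theorem koszul_smul {X Y Z : Π x : M, TangentSpace I x} {g : M → ℝ} {x : M}
    (hX : MDiffAt (T% X) x) (hY : MDiffAt (T% Y) x) (hg : MDiffAt g x) (hZ : MDiffAt (T% Z) x) :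
    koszul I X (g • Y) Z x
      = g x * koszul I X Y Z x + mvfderiv I g x (X x) * inner ℝ (Y x) (Z x) := by
  have h1 := mvfderiv_fun_mul hg (mdifferentiableAt_inner hX hY)
  have h2 := mvfderiv_fun_mul hg (mdifferentiableAt_inner hY hZ)
  simp [koszul, h1, h2, inner_smul_left, inner_add_left, VectorField.mlieBracket_smul_left hg hY,
    VectorField.mlieBracket_smul_right hg hY, inner_smul_right]
  rw [real_inner_comm (X x) (Y x)]
  ring

open Classical in
/-- `∇ Y` at `x`, obtained from the Koszul formula when `Y` is differentiable at `x` (junk value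
`0` otherwise): `∇_v Y = ∑ i, ⟨∇_v Y, e i⟩ e i` for an orthonormal basis `e` of the tangent space
at `x`. -/
def leviCivitaAux (Y : Π x : M, TangentSpace I x) (x : M) :
    TangentSpace I x →L[ℝ] TangentSpace I x :=
  if hY : MDiffAt (T% Y) x then
    let B : TangentSpace I x →L[ℝ] TangentSpace I x →L[ℝ] ℝ :=
      TensorialAt.mkHom₂ (fun X Z ↦ koszul I X Y Z x) x
        (fun _ hZ ↦ koszul_tensorial_left hY hZ) (fun _ hX ↦ koszul_tensorial_right hX hY)
    ∑ i, (B.flip (stdOrthonormalBasis ℝ (TangentSpace I x) i)).smulRight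
        (stdOrthonormalBasis ℝ (TangentSpace I x) i)
  else 0

/-- The Koszul formula. -/
theorem inner_leviCivitaAux {X Y Z : Π x : M, TangentSpace I x} {x : M}
    (hX : MDiffAt (T% X) x) (hY : MDiffAt (T% Y) x) (hZ : MDiffAt (T% Z) x) :
    inner ℝ (leviCivitaAux Y x (X x)) (Z x) = koszul I X Y Z x := by
  have hB := TensorialAt.mkHom₂_apply (Φ := fun X Z ↦ koszul I X Y Z x) (x := x)
        (fun _ hZ ↦ koszul_tensorial_left hY hZ) (fun _ hX ↦ koszul_tensorial_right hX hY) hX hZ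
  rw [← hB]
  simp only [leviCivitaAux, hY, dif_pos, sum_apply, sum_inner,
    ContinuousLinearMap.smulRight_apply, ContinuousLinearMap.flip_apply, inner_smul_left]
  conv_rhs => rw [← (stdOrthonormalBasis ℝ (TangentSpace I x)).sum_repr' (Z x)]
  simp [mul_comm]

variable (I M) in
/-- The Levi-Civita connection; `leviCivita I M Y x v` is `∇_v Y` at `x`. -/
def leviCivita : CovariantDerivative I E (fun x : M ↦ TangentSpace I x) where
  toFun := leviCivitaAux
  isCovariantDerivativeOnUniv :=
    { add := by
        intro Y Y' x hY hY' _
        ext1 v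
        refine ext_inner_right ℝ fun w ↦ ?_
        have hv := FiberBundle.mdifferentiableAt_extend I E v
        have hw := FiberBundle.mdifferentiableAt_extend I E w
        have h := inner_leviCivitaAux hv (mdifferentiableAt_add_section hY hY') hw
        have h1 := inner_leviCivitaAux hv hY hw
        have h2 := inner_leviCivitaAux hv hY' hw
        rw [koszul_add hv hY hY' hw] at h
        simp only [FiberBundle.extend_apply_self] at h h1 h2
        rw [h, add_apply, inner_add_left, h1, h2]
      leibniz := by
        intro Y g x hY hg _
        ext1 v
        refine ext_inner_right ℝ fun w ↦ ?_
        have hv := FiberBundle.mdifferentiableAt_extend I E v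
        have hw := FiberBundle.mdifferentiableAt_extend I E w
        have h := inner_leviCivitaAux hv (MDifferentiableAt.smul_section hg hY) hw
        have h1 := inner_leviCivitaAux hv hY hw
        rw [koszul_smul hv hY hg hw] at h
        simp only [FiberBundle.extend_apply_self] at h h1
        rw [h]
        simp [inner_add_left, inner_smul_left, h1] }

theorem torsion_leviCivita : (leviCivita I M).torsion = 0 := by
  rw [CovariantDerivative.torsion_eq_zero_iff]
  intro X Y x hX hY
  refine ext_inner_right ℝ fun w ↦ ?_
  have hw := FiberBundle.mdifferentiableAt_extend I E w
  have h1 := inner_leviCivitaAux hX hY hw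
  have h2 := inner_leviCivitaAux hY hX hw
  simp only [FiberBundle.extend_apply_self] at h1 h2
  rw [inner_sub_left]
  refine (congr_arg₂ (· - ·) h1 h2).trans ?_
  have e : (fun y ↦ inner ℝ (X y) (Y y)) = fun y ↦ inner ℝ (Y y) (X y) := by
    ext y; exact real_inner_comm _ _
  simp only [koszul, e, VectorField.mlieBracket_swap_apply (V := Y) (W := X),
    inner_neg_left, FiberBundle.extend_apply_self]
  ring

theorem mvfderiv_inner_leviCivita {X Y Z : Π x : M, TangentSpace I x} {x : M}
    (hX : MDiffAt (T% X) x) (hY : MDiffAt (T% Y) x) (hZ : MDiffAt (T% Z) x) :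
    mvfderiv I (fun y ↦ inner ℝ (Y y) (Z y)) x (X x)
      = inner ℝ (leviCivita I M Y x (X x)) (Z x) + inner ℝ (Y x) (leviCivita I M Z x (X x)) := by
  have h1 := inner_leviCivitaAux hX hY hZ
  have h2 := inner_leviCivitaAux hX hZ hY
  rw [real_inner_comm] at h2
  refine Eq.trans ?_ (congr_arg₂ (· + ·) h1 h2).symm
  have e : (fun y ↦ inner ℝ (Y y) (Z y)) = fun y ↦ inner ℝ (Z y) (Y y) := by
    ext y; exact real_inner_comm _ _
  simp only [koszul, e, VectorField.mlieBracket_swap_apply (V := Z) (W := Y), inner_neg_left]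
  ring

end LeviCivita

section Riemannian

variable {E : Type*} [NormedAddCommGroup E] [NormedSpace ℝ E] [FiniteDimensional ℝ E]
  {H : Type*} [TopologicalSpace H] (I : ModelWithCorners ℝ E H)
  {M : Type*} [TopologicalSpace M] [ChartedSpace H M] [IsManifold I ∞ M]
  [RiemannianBundle (fun x : M ↦ TangentSpace I x)]

/-- The gradient of `g` at `p`: `⟨∇g, v⟩ = dg(v)`. -/
def gradient (g : M → ℝ) (p : M) : TangentSpace I p :=
  (InnerProductSpace.toDual ℝ (TangentSpace I p)).symm (mvfderiv I g p)

variable [IsContMDiffRiemannianBundle I ∞ E (fun x : M ↦ TangentSpace I x)]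

/-- `X` is a (smooth) closed conformal vector field: `∇_v X = φ v` for some smooth function `φ`. -/
def IsClosedConformal (X : Π q : M, TangentSpace I q) : Prop :=
  ContMDiff I I.tangent ∞ (fun q ↦ (⟨q, X q⟩ : TangentBundle I M)) ∧
    ∃ φ : M → ℝ, ContMDiff I 𝓘(ℝ, ℝ) ∞ φ ∧
      ∀ (q : M) (v : TangentSpace I q), leviCivita I M X q v = φ q • v

variable {E' : Type*} [NormedAddCommGroup E'] [NormedSpace ℝ E']
  {H' : Type*} [TopologicalSpace H'] (I' : ModelWithCorners ℝ E' H')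
  {P : Type*} [TopologicalSpace P] [ChartedSpace H' P]

/-- The covariant derivative `∇_v V` at `p` of a vector field `V` along a map `f : P → M`, for the
Levi-Civita connection of `M`. If `V = ∑ i, a i • (s i ∘ f)` in the local frame `s` of `TM` given by
the preferred trivialization at `f p`, then this is
`∑ i, (d(a i)(v) • s i (f p) + a i p • ∇_{df(v)} (s i))`; the section `∑ i, a i p • s i` is
`FiberBundle.extend E (V p)`. -/
def covDerivAlong (f : P → M) (V : Π p : P, TangentSpace I (f p)) (p : P)
    (v : TangentSpace I' p) : TangentSpace I (f p) :=
  (trivializationAt E (TangentSpace I : M → Type _) (f p)).symm (f p)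
      (mvfderiv I' (fun r ↦ (trivializationAt E (TangentSpace I : M → Type _) (f p)
        (⟨f r, V r⟩ : TangentBundle I M)).2) p v)
    + leviCivita I M (FiberBundle.extend E (V p)) (f p) (mfderiv I' I f p v)

/-- The velocity field of a curve. -/
def velocity (γ : ℝ → M) (t : ℝ) : TangentSpace I (γ t) :=
  mfderiv 𝓘(ℝ, ℝ) I γ t (1 : ℝ)

/-- `γ` is a geodesic on the open set `s` of parameters: it is differentiable, its velocity field is
differentiable, and `∇_{γ'} γ' = 0`. -/
structure IsGeodesicOn (γ : ℝ → M) (s : Set ℝ) : Prop where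
  mdifferentiableAt : ∀ t ∈ s, MDifferentiableAt 𝓘(ℝ, ℝ) I γ t
  mdifferentiableAt_velocity : ∀ t ∈ s, MDifferentiableAt 𝓘(ℝ, ℝ) I.tangent
    (fun r ↦ (⟨γ r, velocity I γ r⟩ : TangentBundle I M)) t
  covDerivAlong_velocity : ∀ t ∈ s,
    covDerivAlong I 𝓘(ℝ, ℝ) γ (velocity I γ) t (1 : ℝ) = 0

end Riemannian

section Immersed

/-! A hypersurface of `Q` is given by an isometric immersion `f : M → Q`. -/

variable {E : Type*} [NormedAddCommGroup E] [NormedSpace ℝ E] [FiniteDimensional ℝ E]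
  {H : Type*} [TopologicalSpace H] (I : ModelWithCorners ℝ E H)
  {M : Type*} [TopologicalSpace M] [ChartedSpace H M]
  [RiemannianBundle (fun x : M ↦ TangentSpace I x)]
  {E' : Type*} [NormedAddCommGroup E'] [NormedSpace ℝ E'] [FiniteDimensional ℝ E']
  {H' : Type*} [TopologicalSpace H'] (I' : ModelWithCorners ℝ E' H')
  {Q : Type*} [TopologicalSpace Q] [ChartedSpace H' Q]
  [RiemannianBundle (fun x : Q ↦ TangentSpace I' x)]

/-- `f : M → Q` is a smooth isometric immersion, i.e. `M` carries the metric induced by `f`. -/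
structure IsIsometricImmersion (f : M → Q) : Prop where
  contMDiff : ContMDiff I I' ∞ f
  inner_mfderiv : ∀ (p : M) (v w : TangentSpace I p),
    inner ℝ (mfderiv I I' f p v) (mfderiv I I' f p w) = inner ℝ v w

/-- `ξ` is a smooth unit normal vector field along `f`. -/
structure IsUnitNormal [IsManifold I' ∞ Q] (f : M → Q) (ξ : Π p : M, TangentSpace I' (f p)) : Prop where
  contMDiff : ContMDiff I I'.tangent ∞ (fun p ↦ (⟨f p, ξ p⟩ : TangentBundle I' Q))
  norm_eq_one : ∀ p, ‖ξ p‖ = 1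
  inner_eq_zero : ∀ (p : M) (v : TangentSpace I p), inner ℝ (mfderiv I I' f p v) (ξ p) = 0

/-- The tangent part `X^T = X - ⟨X, ξ⟩ ξ` of `X` along `f`, as a vector tangent to `Q`. -/
def tangentPart (f : M → Q) (ξ : Π p : M, TangentSpace I' (f p)) (X : Π q : Q, TangentSpace I' q)
    (p : M) : TangentSpace I' (f p) :=
  X (f p) - inner ℝ (X (f p)) (ξ p) • ξ p

/-- The vector tangent to `M` at `p` that corresponds to a vector `w` orthogonal to the normal:
for an isometric immersion, the adjoint of `df` is the inverse of `df` on the image of `df`. -/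
def pullTangent (f : M → Q) (p : M) (w : TangentSpace I' (f p)) : TangentSpace I p :=
  ContinuousLinearMap.adjoint
    (mfderiv I I' f p : TangentSpace I p →L[ℝ] TangentSpace I' (f p)) w

/-- The unit tangent field `T = X^T / |X^T|` on `M`. -/
def fieldT (f : M → Q) (ξ : Π p : M, TangentSpace I' (f p)) (X : Π q : Q, TangentSpace I' q)
    (p : M) : TangentSpace I p :=
  pullTangent I I' f p (‖tangentPart I' f ξ X p‖⁻¹ • tangentPart I' f ξ X p)

/-- The angle `θ` between `X` and `ξ`. -/
def angleXi (f : M → Q) (ξ : Π p : M, TangentSpace I' (f p)) (X : Π q : Q, TangentSpace I' q)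
    (p : M) : ℝ :=
  InnerProductGeometry.angle (X (f p)) (ξ p)

/-- The angle `θ` is constant, at the points of `S`, along the directions tangent to `M` and
orthogonal to `T`. -/
def AngleConstantOrthogonally (f : M → Q) (ξ : Π p : M, TangentSpace I' (f p))
    (X : Π q : Q, TangentSpace I' q) (S : Set M) : Prop :=
  ∀ p ∈ S, ∀ v : TangentSpace I p, inner ℝ v (fieldT I I' f ξ X p) = 0 →
    mvfderiv I (angleXi I' f ξ X) p v = 0

variable [IsManifold I' ∞ Q] [IsContMDiffRiemannianBundle I' ∞ E' (fun x : Q ↦ TangentSpace I' x)]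

/-- The shape operator: `df (A_ξ v) = - ∇_v ξ`. -/
def shapeOperator (f : M → Q) (ξ : Π p : M, TangentSpace I' (f p)) (p : M)
    (v : TangentSpace I p) : TangentSpace I p :=
  pullTangent I I' f p (-covDerivAlong I' I f ξ p v)

/-- `T` is a principal direction at all points of `S`. -/
def HasCanonicalPrincipalDirection (f : M → Q) (ξ : Π p : M, TangentSpace I' (f p))
    (X : Π q : Q, TangentSpace I' q) (S : Set M) : Prop :=
  ∀ p ∈ S, ∃ c : ℝ, shapeOperator I I' f ξ p (fieldT I I' f ξ X p) = c • fieldT I I' f ξ X p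

end Immersed

section LevelSets

variable {E : Type*} [NormedAddCommGroup E] [NormedSpace ℝ E] [FiniteDimensional ℝ E]
  {H : Type*} [TopologicalSpace H] (I : ModelWithCorners ℝ E H)
  {M : Type*} [TopologicalSpace M] [ChartedSpace H M]
  [RiemannianBundle (fun x : M ↦ TangentSpace I x)]

/-- The norm of the gradient of `g` is constant on each connected component of each level set of the
restriction of `g` to `S`. -/
def GradientNormConstantOnLevels (g : M → ℝ) (S : Set M) : Prop :=
  ∀ p ∈ S, ∀ q ∈ connectedComponentIn (S ∩ g ⁻¹' {g p}) p,
    ‖gradient I g q‖ = ‖gradient I g p‖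

/-- All integral curves of `T` that stay in `S` are geodesics of `M`. -/
def IntegralCurvesAreGeodesics [IsManifold I ∞ M]
    [IsContMDiffRiemannianBundle I ∞ E (fun x : M ↦ TangentSpace I x)]
    (T : Π p : M, TangentSpace I p) (S : Set M) : Prop :=
  ∀ (γ : ℝ → M) (a b : ℝ), (∀ t ∈ Ioo a b, γ t ∈ S) → IsMIntegralCurveOn γ T (Ioo a b) →
    IsGeodesicOn I γ (Ioo a b)

end LevelSets

section Warped

variable {E : Type*} [NormedAddCommGroup E] [NormedSpace ℝ E]
  {H : Type*} [TopologicalSpace H] (I : ModelWithCorners ℝ E H)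
  {N : Type*} [TopologicalSpace N] [ChartedSpace H N]
  [RiemannianBundle (fun x : N ↦ TangentSpace I x)]
  {E' : Type*} [NormedAddCommGroup E'] [NormedSpace ℝ E']
  {H' : Type*} [TopologicalSpace H'] (I' : ModelWithCorners ℝ E' H')
  {Q : Type*} [TopologicalSpace Q] [ChartedSpace H' Q]
  [RiemannianBundle (fun x : Q ↦ TangentSpace I' x)]

/-- The warped product metric `dt² + ϱ(t)² g_N` on `ℝ × N`. -/
def warpedInner (ϱ : ℝ → ℝ) (y : ℝ × N) (v w : TangentSpace (𝓘(ℝ, ℝ).prod I) y) : ℝ :=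
  (v.1 : ℝ) * (w.1 : ℝ)
    + ϱ y.1 ^ 2 * @inner ℝ (TangentSpace I y.2) _ v.2 w.2

/-- `Φ` is an isometry from an open subset `Φ.source` of `Q` onto the warped product `J ×_ϱ N`,
where `J` is an open interval and `ϱ : J → (0, ∞)` is smooth, and it maps the vector field `X` to
`ϱ ∂_t`. -/
structure IsWarpedProductChart (X : Π q : Q, TangentSpace I' q) (J : Set ℝ) (ϱ : ℝ → ℝ)
    (Φ : OpenPartialHomeomorph Q (ℝ × N)) : Prop where
  isOpen_interval : IsOpen J
  ordConnected_interval : J.OrdConnected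
  contDiffOn_warping : ContDiffOn ℝ ∞ ϱ J
  warping_pos : ∀ t ∈ J, 0 < ϱ t
  target_eq : Φ.target = J ×ˢ univ
  contMDiffOn : ContMDiffOn I' (𝓘(ℝ, ℝ).prod I) ∞ Φ Φ.source
  contMDiffOn_symm : ContMDiffOn (𝓘(ℝ, ℝ).prod I) I' ∞ Φ.symm Φ.target
  inner_eq : ∀ q ∈ Φ.source, ∀ v w : TangentSpace I' q,
    inner ℝ v w = warpedInner I ϱ (Φ q) (mfderiv I' (𝓘(ℝ, ℝ).prod I) Φ q v)
      (mfderiv I' (𝓘(ℝ, ℝ).prod I) Φ q w)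
  map_field : ∀ q ∈ Φ.source,
    mfderiv I' (𝓘(ℝ, ℝ).prod I) Φ q (X q) = ((ϱ (Φ q).1, 0) : ℝ × E)

end Warped

end Hypersurface

end

noncomputable section

namespace Hypersurface

section Calculus

variable {E : Type*} [NormedAddCommGroup E] [NormedSpace ℝ E]
  {H : Type*} [TopologicalSpace H] {I : ModelWithCorners ℝ E H}
  {M : Type*} [TopologicalSpace M] [ChartedSpace H M]
  {F : Type*} [NormedAddCommGroup F] [NormedSpace ℝ F]

theorem mvfderiv_congr {g g' : M → F} {p : M} (h : g =ᶠ[𝓝 p] g') :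
    mvfderiv I g p = mvfderiv I g' p := by
  ext v
  exact DFunLike.congr_fun (h.mfderiv_eq (I := I) (I' := 𝓘(ℝ, F))) v

theorem mvfderiv_comp_real {g : M → ℝ} {p : M} {φ : ℝ → ℝ} {φ' : ℝ}
    (hg : MDifferentiableAt I 𝓘(ℝ, ℝ) g p) (hφ : HasDerivAt φ φ' (g p)) (v : TangentSpace I p) :
    mvfderiv I (fun r ↦ φ (g r)) p v = φ' * mvfderiv I g p v := by
  have h := mfderiv_comp_apply (I := I) (I' := 𝓘(ℝ, ℝ)) (I'' := 𝓘(ℝ, ℝ)) p (g := φ) (f := g)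
    hφ.differentiableAt.mdifferentiableAt hg v
  refine h.trans ?_
  rw [mfderiv_eq_fderiv, hφ.hasFDerivAt.fderiv, mul_comm]
  rfl

theorem mvfderiv_clm_comp {F' : Type*} [NormedAddCommGroup F'] [NormedSpace ℝ F'] (L : F →L[ℝ] F')
    {g : M → F} {p : M} (hg : MDifferentiableAt I 𝓘(ℝ, F) g p) (v : TangentSpace I p) :
    mvfderiv I (fun r ↦ L (g r)) p v = L (mvfderiv I g p v) := by
  have h := mfderiv_comp_apply (I := I) (I' := 𝓘(ℝ, F)) (I'' := 𝓘(ℝ, F')) p (g := L) (f := g)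
    L.differentiableAt.mdifferentiableAt hg v
  refine h.trans ?_
  rw [mfderiv_eq_fderiv, L.fderiv]
  rfl

theorem mvfderiv_sum {ι : Type*} (s : Finset ι) {g : ι → M → F} {p : M}
    (hg : ∀ i ∈ s, MDifferentiableAt I 𝓘(ℝ, F) (g i) p) :
    MDifferentiableAt I 𝓘(ℝ, F) (fun r ↦ ∑ i ∈ s, g i r) p ∧
    ∀ v, mvfderiv I (fun r ↦ ∑ i ∈ s, g i r) p v = ∑ i ∈ s, mvfderiv I (g i) p v := by
  classical
  induction s using Finset.induction_on with
  | empty => simp [mvfderiv_const, mdifferentiableAt_const]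
  | insert a s ha ih =>
    have h1 := hg a (Finset.mem_insert_self a s)
    obtain ⟨h2, h3⟩ := ih fun i hi ↦ hg i (Finset.mem_insert_of_mem hi)
    simp only [Finset.sum_insert ha]
    refine ⟨h1.add h2, fun v ↦ ?_⟩
    rw [mvfderiv_fun_add h1 h2, add_apply, h3]

end Calculus

section Trivialization

variable {E : Type*} [NormedAddCommGroup E] [NormedSpace ℝ E]
  {H : Type*} [TopologicalSpace H] {I : ModelWithCorners ℝ E H}
  {M : Type*} [TopologicalSpace M] [ChartedSpace H M] [IsManifold I ∞ M]

variable (I) in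
/-- The coordinates of tangent vectors near `p` in the preferred trivialization at `p`. -/
def tangentCoord (p r : M) : TangentSpace I r →L[ℝ] E :=
  (trivializationAt E (TangentSpace I : M → Type _) p).continuousLinearMapAt ℝ r

theorem tangentCoord_eq {p r : M}
    (hr : r ∈ (trivializationAt E (TangentSpace I : M → Type _) p).baseSet) (v : TangentSpace I r) :
    (trivializationAt E (TangentSpace I : M → Type _) p (⟨r, v⟩ : TangentBundle I M)).2
      = tangentCoord I p r v := by
  rw [tangentCoord, Trivialization.continuousLinearMapAt_apply, Trivialization.linearMapAt_apply,
    if_pos hr]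

variable (I) in
theorem eventually_mem_baseSet (p : M) :
    ∀ᶠ r in 𝓝 p, r ∈ (trivializationAt E (TangentSpace I : M → Type _) p).baseSet :=
  (trivializationAt E (TangentSpace I : M → Type _) p).open_baseSet.mem_nhds
    (FiberBundle.mem_baseSet_trivializationAt' p)

theorem tangentCoord_symm {p r : M}
    (hr : r ∈ (trivializationAt E (TangentSpace I : M → Type _) p).baseSet) (w : E) :
    tangentCoord I p r ((trivializationAt E (TangentSpace I : M → Type _) p).symm r w) = w := by
  rw [← Trivialization.symmL_apply (R := ℝ) _ hr]
  exact Trivialization.continuousLinearMapAt_symmL (R := ℝ) _ hr w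

theorem symm_tangentCoord {p r : M}
    (hr : r ∈ (trivializationAt E (TangentSpace I : M → Type _) p).baseSet) (v : TangentSpace I r) :
    (trivializationAt E (TangentSpace I : M → Type _) p).symm r (tangentCoord I p r v) = v := by
  rw [← Trivialization.symmL_apply (R := ℝ) _ hr]
  exact Trivialization.symmL_continuousLinearMapAt (R := ℝ) _ hr v

theorem extend_eq_symm {p r : M} (v : TangentSpace I p) :
    FiberBundle.extend E v r
      = (trivializationAt E (TangentSpace I : M → Type _) p).symm r (tangentCoord I p p v) := by
  rw [FiberBundle.extend, tangentCoord_eq (FiberBundle.mem_baseSet_trivializationAt' p)]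

theorem tangentCoord_extend {p r : M}
    (hr : r ∈ (trivializationAt E (TangentSpace I : M → Type _) p).baseSet) (v : TangentSpace I p) :
    tangentCoord I p r (FiberBundle.extend E v r) = tangentCoord I p p v := by
  rw [extend_eq_symm, tangentCoord_symm hr]

theorem mdifferentiableAt_tangentCoord {E' : Type*} [NormedAddCommGroup E'] [NormedSpace ℝ E']
    {H' : Type*} [TopologicalSpace H'] {I' : ModelWithCorners ℝ E' H'}
    {P : Type*} [TopologicalSpace P] [ChartedSpace H' P]
    {f : P → M} {V : Π p : P, TangentSpace I (f p)} {p : P} :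
    MDifferentiableAt I' I.tangent (fun r ↦ (⟨f r, V r⟩ : TangentBundle I M)) p ↔
      MDifferentiableAt I' I f p ∧
        MDifferentiableAt I' 𝓘(ℝ, E) (fun r ↦ tangentCoord I (f p) (f r) (V r)) p := by
  rw [mdifferentiableAt_totalSpace]
  refine and_congr_right fun h ↦ ?_
  refine Filter.EventuallyEq.mdifferentiableAt_iff ?_
  filter_upwards [h.continuousAt.eventually (eventually_mem_baseSet I (f p))] with r hr
  exact tangentCoord_eq hr _

theorem contMDiffAt_tangentCoord {E' : Type*} [NormedAddCommGroup E'] [NormedSpace ℝ E']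
    {H' : Type*} [TopologicalSpace H'] {I' : ModelWithCorners ℝ E' H'}
    {P : Type*} [TopologicalSpace P] [ChartedSpace H' P] {n : ℕ∞ω}
    {f : P → M} {V : Π p : P, TangentSpace I (f p)} {p : P} :
    ContMDiffAt I' I.tangent n (fun r ↦ (⟨f r, V r⟩ : TangentBundle I M)) p ↔
      ContMDiffAt I' I n f p ∧
        ContMDiffAt I' 𝓘(ℝ, E) n (fun r ↦ tangentCoord I (f p) (f r) (V r)) p := by
  rw [Bundle.contMDiffAt_totalSpace]
  refine and_congr_right fun h ↦ ?_
  refine Filter.EventuallyEq.contMDiffAt_iff ?_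
  filter_upwards [h.continuousAt.eventually (eventually_mem_baseSet I (f p))] with r hr
  exact tangentCoord_eq hr _

theorem tangentCoord_eq_mfderiv {p r : M} (hr : r ∈ (chartAt H p).source) :
    tangentCoord I p r = (mfderiv I 𝓘(ℝ, E) (extChartAt I p) r : TangentSpace I r →L[ℝ] E) :=
  TangentBundle.continuousLinearMapAt_trivializationAt hr

theorem isCovariantDerivativeOn_flat (q : M) :
    IsCovariantDerivativeOn (I := I) E (V := fun x : M ↦ TangentSpace I x)
      (fun s x ↦ ((trivializationAt E (TangentSpace I : M → Type _) q).symmL ℝ x).comp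
        (mvfderiv I (fun r ↦ tangentCoord I q r (s r)) x)) {q} where
  add {s s' x} hs hs' hx := by
    obtain rfl : x = q := hx
    have h := (mdifferentiableAt_tangentCoord.1 hs).2
    have h' := (mdifferentiableAt_tangentCoord.1 hs').2
    simp only [Pi.add_apply, map_add]
    rw [mvfderiv_fun_add h h', ContinuousLinearMap.comp_add]
  leibniz {s g x} hs hg hx := by
    obtain rfl : x = q := hx
    have h := (mdifferentiableAt_tangentCoord.1 hs).2
    simp only [Pi.smul_apply', map_smul]
    rw [mvfderiv_fun_smul hg h]
    ext v
    simp only [ContinuousLinearMap.comp_add, add_apply, ContinuousLinearMap.comp_apply,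
      ContinuousLinearMap.smulRight_apply, map_smul, smul_apply]
    congr 2
    rw [Trivialization.symmL_apply _ (FiberBundle.mem_baseSet_trivializationAt' x)]
    exact symm_tangentCoord (FiberBundle.mem_baseSet_trivializationAt' x) (s x)

end Trivialization

section AlongMap

variable {E : Type*} [NormedAddCommGroup E] [NormedSpace ℝ E] [FiniteDimensional ℝ E]
  {H : Type*} [TopologicalSpace H] {I : ModelWithCorners ℝ E H}
  {M : Type*} [TopologicalSpace M] [ChartedSpace H M] [IsManifold I ∞ M]
  [RiemannianBundle (fun x : M ↦ TangentSpace I x)]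
  [IsContMDiffRiemannianBundle I ∞ E (fun x : M ↦ TangentSpace I x)]
  {E' : Type*} [NormedAddCommGroup E'] [NormedSpace ℝ E']
  {H' : Type*} [TopologicalSpace H'] {I' : ModelWithCorners ℝ E' H'}
  {P : Type*} [TopologicalSpace P] [ChartedSpace H' P]

theorem covDerivAlong_eq {f : P → M} {V : Π p : P, TangentSpace I (f p)} {p : P}
    (hf : ContinuousAt f p) (v : TangentSpace I' p) :
    covDerivAlong I I' f V p v
      = (trivializationAt E (TangentSpace I : M → Type _) (f p)).symm (f p)
          (mvfderiv I' (fun r ↦ tangentCoord I (f p) (f r) (V r)) p v)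
        + leviCivita I M (FiberBundle.extend E (V p)) (f p) (mfderiv I' I f p v) := by
  rw [covDerivAlong, mvfderiv_congr (g' := fun r ↦ tangentCoord I (f p) (f r) (V r))]
  filter_upwards [hf.eventually (eventually_mem_baseSet I (f p))] with r hr
  exact tangentCoord_eq hr _

theorem covDerivAlong_congr {f : P → M} {V W : Π p : P, TangentSpace I (f p)} {p : P}
    (h : ∀ᶠ r in 𝓝 p, V r = W r) (v : TangentSpace I' p) :
    covDerivAlong I I' f V p v = covDerivAlong I I' f W p v := by
  rw [covDerivAlong, covDerivAlong, h.self_of_nhds]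
  congr 3
  refine mvfderiv_congr ?_
  filter_upwards [h] with r hr
  rw [hr]

theorem leviCivita_eq_flat {s : Π q : M, TangentSpace I q} {q : M} (hs : MDiffAt (T% s) q)
    (u : TangentSpace I q) :
    leviCivita I M s q u
      = (trivializationAt E (TangentSpace I : M → Type _) q).symm q
          (mvfderiv I (fun r ↦ tangentCoord I q r (s r)) q u)
        + leviCivita I M (FiberBundle.extend E (s q)) q u := by
  have hcov : IsCovariantDerivativeOn E (leviCivita I M : _ → _) {q} :=
    (leviCivita I M).isCovariantDerivativeOn
  have h1 := IsCovariantDerivativeOn.difference_apply hcov (isCovariantDerivativeOn_flat q)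
    (mem_singleton q) hs
  have h2 := IsCovariantDerivativeOn.difference_apply hcov (isCovariantDerivativeOn_flat q)
    (mem_singleton q) (FiberBundle.mdifferentiableAt_extend I E (s q))
  rw [FiberBundle.extend_apply_self] at h2
  have h3 := congr($(h1.symm.trans h2) u)
  have h4 : mvfderiv I (fun r ↦ tangentCoord I q r (FiberBundle.extend E (s q) r)) q = 0 := by
    rw [mvfderiv_congr (g' := fun _ ↦ tangentCoord I q q (s q)), mvfderiv_const]
    filter_upwards [eventually_mem_baseSet I q] with r hr
    exact tangentCoord_extend hr _
  simp only [h4, ContinuousLinearMap.comp_zero, sub_zero] at h3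
  rw [← h3, ← Trivialization.symmL_apply (R := ℝ) _ (FiberBundle.mem_baseSet_trivializationAt' q)]
  simp

/-- The covariant derivative along `f` of the restriction of a vector field on the target. -/
theorem covDerivAlong_comp {f : P → M} {s : Π q : M, TangentSpace I q} {p : P}
    (hf : MDifferentiableAt I' I f p) (hs : MDiffAt (T% s) (f p)) (v : TangentSpace I' p) :
    covDerivAlong I I' f (fun r ↦ s (f r)) p v
      = leviCivita I M s (f p) (mfderiv I' I f p v) := by
  rw [covDerivAlong_eq hf.continuousAt, leviCivita_eq_flat hs]
  congr 2
  exact mfderiv_comp_apply p (g := fun r ↦ tangentCoord I (f p) r (s r)) (f := f)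
    (mdifferentiableAt_tangentCoord.1 hs).2 hf v

end AlongMap

section SecondDerivative

variable {E : Type*} [NormedAddCommGroup E] [NormedSpace ℝ E]
  {H : Type*} [TopologicalSpace H] {I : ModelWithCorners ℝ E H} [I.Boundaryless]
  {M : Type*} [TopologicalSpace M] [ChartedSpace H M]
  {F : Type*} [NormedAddCommGroup F] [NormedSpace ℝ F]

theorem lieBracketWithin_eq_zero_of_eventuallyEq_const {V W : E → E} {s : Set E} {x c d : E}
    (hV : V =ᶠ[𝓝 x] fun _ ↦ c) (hW : W =ᶠ[𝓝 x] fun _ ↦ d) :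
    VectorField.lieBracketWithin ℝ V W s x = 0 := by
  rw [hV.lieBracketWithin_vectorField_eq_nhds hW]
  simp [VectorField.lieBracketWithin]

theorem contDiffAt_comp_extChartAt_symm {n : ℕ∞ω} {G : M → F} {p : M}
    (hG : ContMDiffAt I 𝓘(ℝ, F) n G p) :
    ContDiffAt ℝ n (G ∘ (extChartAt I p).symm) (extChartAt I p p) := by
  have h := (contMDiffAt_iff.1 hG).2
  rw [I.range_eq_univ, contDiffWithinAt_univ] at h
  exact h

variable [IsManifold I ∞ M]

/-- The differential of a function in terms of its coordinate expression. -/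
theorem eventually_mvfderiv_eq {G : M → F} {p : M} (hG : ContMDiffAt I 𝓘(ℝ, F) 1 G p) :
    ∀ᶠ r in 𝓝 p, ∀ v : TangentSpace I r, mvfderiv I G r v
      = fderiv ℝ (G ∘ (extChartAt I p).symm) (extChartAt I p r) (tangentCoord I p r v) := by
  have h1 := ((contDiffAt_comp_extChartAt_symm hG).eventually (by simp))
  have h2 := (continuousAt_extChartAt (I := I) p).eventually h1
  have h3 := eventually_eventually_nhds.2 (extChartAt_source_mem_nhds (I := I) p)
  filter_upwards [h2, h3, chart_source_mem_nhds H p] with r hr hr3 hr4 v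
  have hc : MDifferentiableAt I 𝓘(ℝ, E) (extChartAt I p) r := mdifferentiableAt_extChartAt hr4
  have hd : MDifferentiableAt 𝓘(ℝ, E) 𝓘(ℝ, F) (G ∘ (extChartAt I p).symm) (extChartAt I p r) :=
    (hr.differentiableAt (by simp)).mdifferentiableAt
  rw [mvfderiv_congr (g' := fun x ↦ (G ∘ (extChartAt I p).symm) (extChartAt I p x))]
  · have h := mfderiv_comp_apply r (g := G ∘ (extChartAt I p).symm) (f := extChartAt I p) hd hc v
    refine h.trans ?_
    rw [mfderiv_eq_fderiv, tangentCoord_eq_mfderiv hr4]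
    rfl
  · filter_upwards [hr3] with x hx
    exact congr_arg G ((extChartAt I p).left_inv hx).symm

theorem mvfderiv_extend_eq {G : M → F} {p : M} (hG : ContMDiffAt I 𝓘(ℝ, F) 2 G p)
    (w : TangentSpace I p) :
    (fun r ↦ mvfderiv I G r (FiberBundle.extend E w r)) =ᶠ[𝓝 p]
      fun r ↦ fderiv ℝ (G ∘ (extChartAt I p).symm) (extChartAt I p r) (tangentCoord I p p w) := by
  filter_upwards [eventually_mvfderiv_eq (hG.of_le one_le_two), eventually_mem_baseSet I p]
    with r hr hr2
  rw [hr, tangentCoord_extend hr2]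

theorem mvfderiv_mvfderiv_extend {G : M → F} {p : M} (hG : ContMDiffAt I 𝓘(ℝ, F) 2 G p)
    (v w : TangentSpace I p) :
    MDifferentiableAt I 𝓘(ℝ, F) (fun r ↦ mvfderiv I G r (FiberBundle.extend E w r)) p ∧
    mvfderiv I (fun r ↦ mvfderiv I G r (FiberBundle.extend E w r)) p v
      = fderiv ℝ (fderiv ℝ (G ∘ (extChartAt I p).symm)) (extChartAt I p p)
          (tangentCoord I p p v) (tangentCoord I p p w) := by
  have h1 : DifferentiableAt ℝ (fderiv ℝ (G ∘ (extChartAt I p).symm)) (extChartAt I p p) :=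
    ((contDiffAt_comp_extChartAt_symm hG).fderiv_right (m := 1) (by norm_num)).differentiableAt
      (by simp)
  have h2 := h1.mdifferentiableAt
  have hc : MDifferentiableAt I 𝓘(ℝ, E) (extChartAt I p) p :=
    mdifferentiableAt_extChartAt (mem_chart_source H p)
  have h3 := h2.comp p hc
  rw [(mvfderiv_extend_eq hG w).mdifferentiableAt_iff, mvfderiv_congr (mvfderiv_extend_eq hG w)]
  let L := ContinuousLinearMap.apply ℝ F (tangentCoord I p p w)
  constructor
  · exact L.differentiableAt.mdifferentiableAt.comp p h3
  · refine (mvfderiv_clm_comp L h3 v).trans ?_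
    have h := mfderiv_comp_apply p (g := fderiv ℝ (G ∘ (extChartAt I p).symm))
      (f := extChartAt I p) h2 hc v
    refine (congr_arg L h).trans ?_
    have h' : tangentCoord I p p v = mfderiv I 𝓘(ℝ, E) (extChartAt I p) p v := by
      rw [tangentCoord_eq_mfderiv (mem_chart_source H p)]
      rfl
    rw [mfderiv_eq_fderiv, h']
    exact ContinuousLinearMap.apply_apply _ _

theorem mvfderiv_mvfderiv_extend_comm {G : M → F} {p : M} (hG : ContMDiffAt I 𝓘(ℝ, F) 2 G p)
    (v w : TangentSpace I p) :
    mvfderiv I (fun r ↦ mvfderiv I G r (FiberBundle.extend E w r)) p v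
      = mvfderiv I (fun r ↦ mvfderiv I G r (FiberBundle.extend E v r)) p w := by
  rw [(mvfderiv_mvfderiv_extend hG v w).2, (mvfderiv_mvfderiv_extend hG w v).2]
  exact (contDiffAt_comp_extChartAt_symm hG).isSymmSndFDerivAt (by simp) _ _

theorem mlieBracket_extend [CompleteSpace E] {p : M} (v w : TangentSpace I p) :
    VectorField.mlieBracket I (FiberBundle.extend E v) (FiberBundle.extend E w) p = 0 := by
  have key : ∀ u : TangentSpace I p, VectorField.mpullbackWithin 𝓘(ℝ, E) I (extChartAt I p).symm
      (FiberBundle.extend E u) (range I) =ᶠ[𝓝 (extChartAt I p p)]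
        fun _ ↦ tangentCoord I p p u := by
    intro u
    filter_upwards [extChartAt_target_mem_nhds (I := I) p] with y hy
    have hs : (extChartAt I p).symm y ∈ (chartAt H p).source := by
      simpa using (extChartAt I p).map_target hy
    have hb : (extChartAt I p).symm y ∈
        (trivializationAt E (TangentSpace I : M → Type _) p).baseSet := by simpa using hs
    have h1 := isInvertible_mfderivWithin_extChartAt_symm hy
    have h2 := TangentBundle.symmL_trivializationAt (I := I) hs
    rw [(extChartAt I p).right_inv hy] at h2
    rw [VectorField.mpullbackWithin_apply, extend_eq_symm,
      ← Trivialization.symmL_apply (R := ℝ) _ hb, h2]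
    exact h1.inverse_apply_eq.2 rfl
  have hv := key v
  have hw := key w
  rw [← VectorField.mlieBracketWithin_univ, VectorField.mlieBracketWithin_apply]
  rw [I.range_eq_univ] at hv hw ⊢
  refine (congr_arg _ (lieBracketWithin_eq_zero_of_eventuallyEq_const hv hw)).trans ?_
  exact map_zero _

end SecondDerivative

section Fields

variable {E : Type*} [NormedAddCommGroup E] [NormedSpace ℝ E]
  {H : Type*} [TopologicalSpace H] {I : ModelWithCorners ℝ E H}
  {M : Type*} [TopologicalSpace M] [ChartedSpace H M] [IsManifold I ∞ M]
  {E' : Type*} [NormedAddCommGroup E'] [NormedSpace ℝ E']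
  {H' : Type*} [TopologicalSpace H'] {I' : ModelWithCorners ℝ E' H'}
  {P : Type*} [TopologicalSpace P] [ChartedSpace H' P]

theorem mdifferentiableAt_extend_along {f : P → M} {p : P} (hf : MDifferentiableAt I' I f p)
    (x : TangentSpace I (f p)) :
    MDifferentiableAt I' I.tangent
      (fun r ↦ (⟨f r, FiberBundle.extend E x (f r)⟩ : TangentBundle I M)) p :=
  (FiberBundle.mdifferentiableAt_extend I E x).comp p hf

theorem contMDiffAt_mfderiv_extend [IsManifold I' ∞ P] {f : P → M} (hf : ContMDiff I' I ∞ f) (p : P)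
    (w : TangentSpace I' p) :
    ContMDiffAt I' I.tangent ∞
      (fun r ↦ (⟨f r, mfderiv I' I f r (FiberBundle.extend E' w r)⟩ : TangentBundle I M)) p :=
  (hf.contMDiff_tangentMap (m := ∞) (by simp)).contMDiffAt.comp p
    (FiberBundle.contMDiffAt_extend I' E' w)

variable [RiemannianBundle (fun x : M ↦ TangentSpace I x)]
  [IsContMDiffRiemannianBundle I ∞ E (fun x : M ↦ TangentSpace I x)]

theorem mdifferentiableAt_inner_along {f : P → M} {V W : Π p : P, TangentSpace I (f p)} {p : P}
    (hV : MDifferentiableAt I' I.tangent (fun r ↦ (⟨f r, V r⟩ : TangentBundle I M)) p)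
    (hW : MDifferentiableAt I' I.tangent (fun r ↦ (⟨f r, W r⟩ : TangentBundle I M)) p) :
    MDifferentiableAt I' 𝓘(ℝ, ℝ) (fun r ↦ inner ℝ (V r) (W r)) p :=
  MDifferentiableAt.inner_bundle (F := E) (E := fun x : M ↦ TangentSpace I x) hV hW

end Fields

section AlongMap

variable {E : Type*} [NormedAddCommGroup E] [NormedSpace ℝ E] [FiniteDimensional ℝ E]
  {H : Type*} [TopologicalSpace H] {I : ModelWithCorners ℝ E H}
  {M : Type*} [TopologicalSpace M] [ChartedSpace H M] [IsManifold I ∞ M]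
  [RiemannianBundle (fun x : M ↦ TangentSpace I x)]
  [IsContMDiffRiemannianBundle I ∞ E (fun x : M ↦ TangentSpace I x)]
  {E' : Type*} [NormedAddCommGroup E'] [NormedSpace ℝ E']
  {H' : Type*} [TopologicalSpace H'] {I' : ModelWithCorners ℝ E' H'}
  {P : Type*} [TopologicalSpace P] [ChartedSpace H' P]

theorem leviCivita_extend_comm [I.Boundaryless] {q : M} (v w : TangentSpace I q) :
    leviCivita I M (FiberBundle.extend E w) q v = leviCivita I M (FiberBundle.extend E v) q w := by
  have h := (leviCivita I M).torsion_eq_zero_iff.1 torsion_leviCivita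
    (FiberBundle.mdifferentiableAt_extend I E v) (FiberBundle.mdifferentiableAt_extend I E w)
  rw [mlieBracket_extend, FiberBundle.extend_apply_self, FiberBundle.extend_apply_self] at h
  exact sub_eq_zero.1 h

theorem mvfderiv_inner_along_of_eq_zero {f : P → M} {V W : Π p : P, TangentSpace I (f p)} {p : P}
    (hV : MDifferentiableAt I' I.tangent (fun r ↦ (⟨f r, V r⟩ : TangentBundle I M)) p)
    (hW : MDifferentiableAt I' I.tangent (fun r ↦ (⟨f r, W r⟩ : TangentBundle I M)) p)
    (h0 : V p = 0) (v : TangentSpace I' p) :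
    mvfderiv I' (fun r ↦ inner ℝ (V r) (W r)) p v
      = inner ℝ ((trivializationAt E (TangentSpace I : M → Type _) (f p)).symm (f p)
          (mvfderiv I' (fun r ↦ tangentCoord I (f p) (f r) (V r)) p v)) (W p) := by
  obtain ⟨hf, ha⟩ := mdifferentiableAt_tangentCoord.1 hV
  set e := trivializationAt E (TangentSpace I : M → Type _) (f p) with he
  set a := fun r ↦ tangentCoord I (f p) (f r) (V r) with ha_def
  let b := Module.finBasis ℝ E
  have hp : f p ∈ e.baseSet := FiberBundle.mem_baseSet_trivializationAt' (f p)
  have hs : ∀ i, MDifferentiableAt I' I.tangent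
      (fun r ↦ (⟨f r, e.symm (f r) (b i)⟩ : TangentBundle I M)) p := by
    intro i
    refine mdifferentiableAt_tangentCoord.2 ⟨hf, ?_⟩
    refine (mdifferentiableAt_const (c := b i)).congr_of_eventuallyEq ?_
    filter_upwards [hf.continuousAt.eventually (eventually_mem_baseSet I (f p))] with r hr
    exact tangentCoord_symm hr _
  have hsum : ∀ r, f r ∈ e.baseSet → ∀ x : E,
      e.symm (f r) x = ∑ i, b.coord i x • e.symm (f r) (b i) := by
    intro r hr x
    simp only [← Trivialization.symmL_apply (R := ℝ) _ hr]
    conv_lhs => rw [← b.sum_repr x, map_sum]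
    simp only [map_smul, Module.Basis.coord_apply]
  have hc : ∀ i, MDifferentiableAt I' 𝓘(ℝ, ℝ) (fun r ↦ b.coord i (a r)) p := fun i ↦
    (LinearMap.toContinuousLinearMap (b.coord i)).differentiableAt.mdifferentiableAt.comp p ha
  have hi : ∀ i, MDifferentiableAt I' 𝓘(ℝ, ℝ) (fun r ↦ inner ℝ (e.symm (f r) (b i)) (W r)) p :=
    fun i ↦ mdifferentiableAt_inner_along (hs i) hW
  have heq : (fun r ↦ inner ℝ (V r) (W r)) =ᶠ[𝓝 p]
      fun r ↦ ∑ i, b.coord i (a r) * inner ℝ (e.symm (f r) (b i)) (W r) := by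
    filter_upwards [hf.continuousAt.eventually (eventually_mem_baseSet I (f p))] with r hr
    have : V r = e.symm (f r) (a r) := (symm_tangentCoord hr (V r)).symm
    conv_lhs => rw [this, hsum r hr, sum_inner]
    simp [inner_smul_left]
  rw [mvfderiv_congr heq, (mvfderiv_sum (I := I') Finset.univ
    (g := fun i r ↦ b.coord i (a r) * inner ℝ (e.symm (f r) (b i)) (W r))
    fun i _ ↦ (hc i).mul (hi i)).2, hsum p hp, sum_inner]
  refine Finset.sum_congr rfl fun i _ ↦ ?_
  rw [mvfderiv_fun_mul (hc i) (hi i)]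
  have h0' : a p = 0 := by simp [ha_def, h0]
  have hd := mvfderiv_clm_comp (LinearMap.toContinuousLinearMap (b.coord i)) ha v
  simp only [LinearMap.coe_toContinuousLinearMap'] at hd
  simp only [smul_apply, h0', map_zero, zero_smul, zero_add, hd, inner_smul_left,
    smul_eq_mul]
  simp [mul_comm]

/-- The Levi-Civita connection along a map is compatible with the metric. -/
theorem mvfderiv_inner_along {f : P → M} {V W : Π p : P, TangentSpace I (f p)} {p : P}
    (hV : MDifferentiableAt I' I.tangent (fun r ↦ (⟨f r, V r⟩ : TangentBundle I M)) p)
    (hW : MDifferentiableAt I' I.tangent (fun r ↦ (⟨f r, W r⟩ : TangentBundle I M)) p)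
    (v : TangentSpace I' p) :
    mvfderiv I' (fun r ↦ inner ℝ (V r) (W r)) p v
      = inner ℝ (covDerivAlong I I' f V p v) (W p)
        + inner ℝ (V p) (covDerivAlong I I' f W p v) := by
  obtain ⟨hf, ha⟩ := mdifferentiableAt_tangentCoord.1 hV
  have sub : ∀ U : Π p : P, TangentSpace I (f p),
      MDifferentiableAt I' I.tangent (fun r ↦ (⟨f r, U r⟩ : TangentBundle I M)) p →
      MDifferentiableAt I' I.tangent
        (fun r ↦ (⟨f r, U r - FiberBundle.extend E (U p) (f r)⟩ : TangentBundle I M)) p ∧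
      mvfderiv I' (fun r ↦ tangentCoord I (f p) (f r)
        (U r - FiberBundle.extend E (U p) (f r))) p v =
      mvfderiv I' (fun r ↦ tangentCoord I (f p) (f r) (U r)) p v := by
    intro U hU
    have ha := (mdifferentiableAt_tangentCoord.1 hU).2
    have heq : (fun r ↦ tangentCoord I (f p) (f r) (U r - FiberBundle.extend E (U p) (f r)))
        =ᶠ[𝓝 p] fun r ↦ tangentCoord I (f p) (f r) (U r) - tangentCoord I (f p) (f p) (U p) := by
      filter_upwards [hf.continuousAt.eventually (eventually_mem_baseSet I (f p))] with r hr
      rw [map_sub, tangentCoord_extend hr]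
    constructor
    · refine mdifferentiableAt_tangentCoord.2 ⟨hf, ?_⟩
      exact (ha.sub mdifferentiableAt_const).congr_of_eventuallyEq heq
    · rw [mvfderiv_congr heq, mvfderiv_fun_sub ha mdifferentiableAt_const, mvfderiv_const,
        sub_zero]
  have hV0 := mdifferentiableAt_extend_along hf (V p)
  have hW0 := mdifferentiableAt_extend_along hf (W p)
  obtain ⟨hV1, hV1'⟩ := sub V hV
  obtain ⟨hW1, hW1'⟩ := sub W hW
  have e1 := mvfderiv_inner_along_of_eq_zero hV1 hW (by simp) v
  have e2 := mvfderiv_inner_along_of_eq_zero hW1 hV0 (by simp) v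
  have e3 : mvfderiv I' (fun r ↦ inner ℝ (FiberBundle.extend E (V p) (f r))
      (FiberBundle.extend E (W p) (f r))) p v = _ :=
    mfderiv_comp_apply p (g := fun q ↦ inner ℝ (FiberBundle.extend E (V p) q)
      (FiberBundle.extend E (W p) q)) (f := f) (mdifferentiableAt_inner
      (FiberBundle.mdifferentiableAt_extend I E (V p))
      (FiberBundle.mdifferentiableAt_extend I E (W p))) hf v
  have e4 := mvfderiv_inner_leviCivita
      (FiberBundle.mdifferentiableAt_extend I E (mfderiv I' I f p v))
      (FiberBundle.mdifferentiableAt_extend I E (V p))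
      (FiberBundle.mdifferentiableAt_extend I E (W p))
  simp only [FiberBundle.extend_apply_self] at e4
  have e5 := e3.trans e4
  rw [hV1'] at e1
  rw [hW1'] at e2
  have split : (fun r ↦ inner ℝ (V r) (W r)) = fun r ↦
      (inner ℝ (V r - FiberBundle.extend E (V p) (f r)) (W r)
        + inner ℝ (W r - FiberBundle.extend E (W p) (f r)) (FiberBundle.extend E (V p) (f r)))
        + inner ℝ (FiberBundle.extend E (V p) (f r)) (FiberBundle.extend E (W p) (f r)) := by
    ext r
    rw [real_inner_comm _ (W r - _), inner_sub_left, inner_sub_right]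
    ring
  have d1 := mdifferentiableAt_inner_along hV1 hW
  have d2 := mdifferentiableAt_inner_along hW1 hV0
  have d3 := mdifferentiableAt_inner_along hV0 hW0
  have d12 : MDifferentiableAt I' 𝓘(ℝ, ℝ) (fun r ↦
      inner ℝ (V r - FiberBundle.extend E (V p) (f r)) (W r)
        + inner ℝ (W r - FiberBundle.extend E (W p) (f r)) (FiberBundle.extend E (V p) (f r))) p :=
    d1.add d2
  rw [split, mvfderiv_fun_add d12 d3, add_apply, mvfderiv_fun_add d1 d2, add_apply, e1, e2,
    e5, covDerivAlong_eq hf.continuousAt, covDerivAlong_eq hf.continuousAt]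
  simp only [FiberBundle.extend_apply_self, inner_add_left, inner_add_right]
  rw [real_inner_comm (V p)]
  ring

end AlongMap

section TangentMap

variable {E : Type*} [NormedAddCommGroup E] [NormedSpace ℝ E] [FiniteDimensional ℝ E]
  {H : Type*} [TopologicalSpace H] {I : ModelWithCorners ℝ E H} [I.Boundaryless]
  {M : Type*} [TopologicalSpace M] [ChartedSpace H M] [IsManifold I ∞ M]
  [RiemannianBundle (fun x : M ↦ TangentSpace I x)]
  [IsContMDiffRiemannianBundle I ∞ E (fun x : M ↦ TangentSpace I x)]
  {E' : Type*} [NormedAddCommGroup E'] [NormedSpace ℝ E']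
  {H' : Type*} [TopologicalSpace H'] {I' : ModelWithCorners ℝ E' H'} [I'.Boundaryless]
  {P : Type*} [TopologicalSpace P] [ChartedSpace H' P] [IsManifold I' ∞ P]

/-- The Levi-Civita connection along a map is torsion free. -/
theorem covDerivAlong_mfderiv_extend_comm {f : P → M} (hf : ContMDiff I' I ∞ f) {p : P}
    (v w : TangentSpace I' p) :
    covDerivAlong I I' f (fun r ↦ mfderiv I' I f r (FiberBundle.extend E' w r)) p v
      = covDerivAlong I I' f (fun r ↦ mfderiv I' I f r (FiberBundle.extend E' v r)) p w := by
  have hcont := hf.continuous.continuousAt (x := p)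
  have hG : ContMDiffAt I' 𝓘(ℝ, E) 2 (fun r ↦ extChartAt I (f p) (f r)) p :=
    ((contMDiffAt_extChartAt (I := I) (n := ∞) (x := f p)).comp p hf.contMDiffAt).of_le
      ENat.LEInfty.out
  have key : ∀ u : TangentSpace I' p,
      (fun r ↦ tangentCoord I (f p) (f r) (mfderiv I' I f r (FiberBundle.extend E' u r)))
      =ᶠ[𝓝 p] fun r ↦ mvfderiv I' (fun r ↦ extChartAt I (f p) (f r)) r
        (FiberBundle.extend E' u r) := by
    intro u
    filter_upwards [hcont.eventually (chart_source_mem_nhds H (f p))] with r hr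
    rw [tangentCoord_eq_mfderiv hr]
    exact (mfderiv_comp_apply r (g := extChartAt I (f p)) (f := f)
      (mdifferentiableAt_extChartAt hr) (hf.mdifferentiableAt (by simp)) _).symm
  rw [covDerivAlong_eq hcont, covDerivAlong_eq hcont, mvfderiv_congr (key w),
    mvfderiv_congr (key v), mvfderiv_mvfderiv_extend_comm hG]
  simp only [FiberBundle.extend_apply_self]
  rw [leviCivita_extend_comm]

end TangentMap

section Pointwise

set_option linter.unusedSectionVars false

variable {E : Type*} [NormedAddCommGroup E] [NormedSpace ℝ E] [FiniteDimensional ℝ E]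
  {H : Type*} [TopologicalSpace H] {I : ModelWithCorners ℝ E H}
  {M : Type*} [TopologicalSpace M] [ChartedSpace H M]
  [RiemannianBundle (fun x : M ↦ TangentSpace I x)]
  {E' : Type*} [NormedAddCommGroup E'] [NormedSpace ℝ E'] [FiniteDimensional ℝ E']
  {H' : Type*} [TopologicalSpace H'] {I' : ModelWithCorners ℝ E' H'}
  {Q : Type*} [TopologicalSpace Q] [ChartedSpace H' Q]
  [RiemannianBundle (fun x : Q ↦ TangentSpace I' x)]
  {f : M → Q} {ξ : Π p : M, TangentSpace I' (f p)} {X : Π q : Q, TangentSpace I' q}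

theorem inner_pullTangent (p : M) (w : TangentSpace I' (f p)) (v : TangentSpace I p) :
    inner ℝ (pullTangent I I' f p w) v = inner ℝ w (mfderiv I I' f p v) :=
  ContinuousLinearMap.adjoint_inner_left _ _ _

variable [IsManifold I' ∞ Q]

theorem mfderiv_pullTangent (hf : IsIsometricImmersion I I' f) (hξ : IsUnitNormal I I' f ξ)
    (hdim : Module.finrank ℝ E' = Module.finrank ℝ E + 1) {p : M} {w : TangentSpace I' (f p)}
    (hw : inner ℝ w (ξ p) = 0) : mfderiv I I' f p (pullTangent I I' f p w) = w := by
  let L : TangentSpace I p →ₗ[ℝ] TangentSpace I' (f p) := (mfderiv I I' f p).toLinearMap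
  have hL : ∀ v, L v = mfderiv I I' f p v := fun _ ↦ rfl
  have hinj : Function.Injective L := by
    rw [injective_iff_map_eq_zero]
    intro v hv
    have h := hf.inner_mfderiv p v v
    rw [← hL, hv, inner_zero_left] at h
    exact inner_self_eq_zero.1 h.symm
  have hξ0 : ξ p ≠ 0 := norm_ne_zero_iff.1 (by rw [hξ.norm_eq_one]; exact one_ne_zero)
  have hle : LinearMap.range L ≤ (ℝ ∙ ξ p)ᗮ := by
    rintro _ ⟨v, rfl⟩
    rw [Submodule.mem_orthogonal_singleton_iff_inner_left]
    exact hξ.inner_eq_zero p v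
  have hrange : LinearMap.range L = (ℝ ∙ ξ p)ᗮ := by
    refine Submodule.eq_of_le_of_finrank_eq hle ?_
    rw [LinearMap.finrank_range_of_inj hinj]
    have h1 := (ℝ ∙ ξ p).finrank_add_finrank_orthogonal
    rw [finrank_span_singleton hξ0] at h1
    have h2 : Module.finrank ℝ (TangentSpace I' (f p)) = Module.finrank ℝ E' := rfl
    have h3 : Module.finrank ℝ (TangentSpace I p) = Module.finrank ℝ E := rfl
    omega
  have hw' : w ∈ LinearMap.range L := by
    rw [hrange, Submodule.mem_orthogonal_singleton_iff_inner_left]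
    exact hw
  obtain ⟨u, rfl⟩ := hw'
  have : pullTangent I I' f p (L u) = u := by
    refine ext_inner_right ℝ fun v ↦ ?_
    rw [inner_pullTangent]
    exact hf.inner_mfderiv p u v
  rw [this]
  rfl

theorem inner_tangentPart_normal (hξ : IsUnitNormal I I' f ξ) (p : M) :
    inner ℝ (tangentPart I' f ξ X p) (ξ p) = 0 := by
  rw [tangentPart, inner_sub_left, inner_smul_left, real_inner_self_eq_norm_sq, hξ.norm_eq_one]
  simp

theorem inner_tangentPart_of_orthogonal {p : M} {w : TangentSpace I' (f p)}
    (hw : inner ℝ (ξ p) w = 0) : inner ℝ (tangentPart I' f ξ X p) w = inner ℝ (X (f p)) w := by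
  rw [tangentPart, inner_sub_left, inner_smul_left, hw, mul_zero, sub_zero]

theorem norm_tangentPart_sq (hξ : IsUnitNormal I I' f ξ) (p : M) :
    ‖tangentPart I' f ξ X p‖ ^ 2
      = inner ℝ (X (f p)) (X (f p)) - inner ℝ (X (f p)) (ξ p) ^ 2 := by
  rw [← real_inner_self_eq_norm_sq]
  conv_lhs => rw [tangentPart, inner_sub_right, ← tangentPart, inner_smul_right,
    inner_tangentPart_normal hξ, mul_zero, sub_zero, tangentPart, inner_sub_left, inner_smul_left,
    real_inner_comm (X (f p)) (ξ p)]
  simp [sq]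

theorem inner_fieldT (hξ : IsUnitNormal I I' f ξ) (p : M) (v : TangentSpace I p) :
    inner ℝ (fieldT I I' f ξ X p) v
      = ‖tangentPart I' f ξ X p‖⁻¹ * inner ℝ (X (f p)) (mfderiv I I' f p v) := by
  rw [fieldT, inner_pullTangent, inner_smul_left, inner_tangentPart_of_orthogonal]
  · rfl
  · rw [real_inner_comm]
    exact hξ.inner_eq_zero p v

theorem mfderiv_fieldT (hf : IsIsometricImmersion I I' f) (hξ : IsUnitNormal I I' f ξ)
    (hdim : Module.finrank ℝ E' = Module.finrank ℝ E + 1) (p : M) :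
    mfderiv I I' f p (fieldT I I' f ξ X p)
      = ‖tangentPart I' f ξ X p‖⁻¹ • tangentPart I' f ξ X p := by
  refine mfderiv_pullTangent hf hξ hdim ?_
  rw [inner_smul_left, inner_tangentPart_normal hξ, mul_zero]

theorem inner_fieldT_self (hf : IsIsometricImmersion I I' f) (hξ : IsUnitNormal I I' f ξ)
    (hdim : Module.finrank ℝ E' = Module.finrank ℝ E + 1) {p : M}
    (hp : tangentPart I' f ξ X p ≠ 0) :
    inner ℝ (fieldT I I' f ξ X p) (fieldT I I' f ξ X p) = 1 := by
  rw [← hf.inner_mfderiv, mfderiv_fieldT hf hξ hdim, inner_smul_left, inner_smul_right,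
    real_inner_self_eq_norm_sq]
  have := norm_ne_zero_iff.2 hp
  simp only [conj_trivial]
  field_simp

/-- The cosine of the angle between `X` and `ξ`. -/
def cosAngle (f : M → Q) (ξ : Π p : M, TangentSpace I' (f p)) (X : Π q : Q, TangentSpace I' q)
    (p : M) : ℝ :=
  inner ℝ (X (f p)) (ξ p) * ‖X (f p)‖⁻¹

theorem angleXi_eq_arccos (hξ : IsUnitNormal I I' f ξ) :
    angleXi I' f ξ X = fun p ↦ Real.arccos (cosAngle f ξ X p) := by
  ext p
  rw [angleXi, InnerProductGeometry.angle, cosAngle, hξ.norm_eq_one, mul_one, div_eq_mul_inv]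

theorem field_ne_zero {p : M} (hp : tangentPart I' f ξ X p ≠ 0) : X (f p) ≠ 0 := by
  intro h
  apply hp
  simp [tangentPart, h]

theorem one_sub_cosAngle_sq (hξ : IsUnitNormal I I' f ξ) {p : M}
    (hp : tangentPart I' f ξ X p ≠ 0) :
    1 - cosAngle f ξ X p ^ 2 = (‖tangentPart I' f ξ X p‖ * ‖X (f p)‖⁻¹) ^ 2 := by
  have h := norm_ne_zero_iff.2 (field_ne_zero hp)
  rw [mul_pow, norm_tangentPart_sq hξ, cosAngle, mul_pow, real_inner_self_eq_norm_sq]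
  field_simp

theorem one_sub_cosAngle_sq_pos (hξ : IsUnitNormal I I' f ξ) {p : M}
    (hp : tangentPart I' f ξ X p ≠ 0) : 0 < 1 - cosAngle f ξ X p ^ 2 := by
  rw [one_sub_cosAngle_sq hξ hp]
  have h := norm_pos_iff.2 (field_ne_zero hp)
  have h' := norm_pos_iff.2 hp
  positivity

theorem cosAngle_ne_zero (hξ : IsUnitNormal I I' f ξ) {p : M}
    (hp : angleXi I' f ξ X p ≠ Real.pi / 2) : cosAngle f ξ X p ≠ 0 := by
  intro h
  apply hp
  rw [angleXi_eq_arccos hξ]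
  simp only [h, Real.arccos_zero]

variable [IsManifold I ∞ M] [IsContMDiffRiemannianBundle I ∞ E (fun x : M ↦ TangentSpace I x)]
  [IsContMDiffRiemannianBundle I' ∞ E' (fun x : Q ↦ TangentSpace I' x)]

theorem inner_shapeOperator (p : M) (v w : TangentSpace I p) :
    inner ℝ (shapeOperator I I' f ξ p v) w
      = -inner ℝ (covDerivAlong I' I f ξ p v) (mfderiv I I' f p w) := by
  rw [shapeOperator, inner_pullTangent, inner_neg_left]

theorem IsUnitNormal.mdifferentiableAt (hξ : IsUnitNormal I I' f ξ) (p : M) :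
    MDifferentiableAt I I'.tangent (fun r ↦ (⟨f r, ξ r⟩ : TangentBundle I' Q)) p :=
  hξ.contMDiff.mdifferentiableAt (by simp)

theorem IsClosedConformal.mdifferentiableAt (hX : IsClosedConformal I' X) (q : Q) :
    MDiffAt (T% X) q :=
  hX.1.mdifferentiableAt (by simp)

theorem inner_covDerivAlong_normal (hξ : IsUnitNormal I I' f ξ) (p : M) (v : TangentSpace I p) :
    inner ℝ (covDerivAlong I' I f ξ p v) (ξ p) = 0 := by
  have h := mvfderiv_inner_along (hξ.mdifferentiableAt p) (hξ.mdifferentiableAt p) v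
  have h1 : (fun r ↦ inner ℝ (ξ r) (ξ r)) = fun _ ↦ (1 : ℝ) := by
    ext r
    rw [real_inner_self_eq_norm_sq, hξ.norm_eq_one, one_pow]
  rw [h1, mvfderiv_const, real_inner_comm _ (ξ p)] at h
  simp only [zero_apply] at h
  linarith

theorem inner_covDerivAlong_normal_mfderiv_comm [I.Boundaryless] [I'.Boundaryless]
    (hf : IsIsometricImmersion I I' f) (hξ : IsUnitNormal I I' f ξ) (p : M)
    (v w : TangentSpace I p) :
    inner ℝ (covDerivAlong I' I f ξ p v) (mfderiv I I' f p w)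
      = inner ℝ (covDerivAlong I' I f ξ p w) (mfderiv I I' f p v) := by
  have key : ∀ v w : TangentSpace I p,
      inner ℝ (covDerivAlong I' I f ξ p v) (mfderiv I I' f p w) = - inner ℝ (ξ p)
        (covDerivAlong I' I f (fun r ↦ mfderiv I I' f r (FiberBundle.extend E w r)) p v) := by
    intro v w
    have h := mvfderiv_inner_along (hξ.mdifferentiableAt p)
      ((contMDiffAt_mfderiv_extend hf.contMDiff p w).mdifferentiableAt (by simp)) v
    have h1 : (fun r ↦ inner ℝ (ξ r) (mfderiv I I' f r (FiberBundle.extend E w r)))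
        = fun _ ↦ (0 : ℝ) := by
      ext r
      rw [real_inner_comm, hξ.inner_eq_zero]
    rw [h1, mvfderiv_const] at h
    simp only [zero_apply, FiberBundle.extend_apply_self] at h
    linarith
  rw [key v w, key w v, covDerivAlong_mfderiv_extend_comm hf.contMDiff]

theorem mdifferentiableAt_field_along (hf : IsIsometricImmersion I I' f)
    (hX : IsClosedConformal I' X) (p : M) :
    MDifferentiableAt I I'.tangent (fun r ↦ (⟨f r, X (f r)⟩ : TangentBundle I' Q)) p :=
  (hX.mdifferentiableAt (f p)).comp p (hf.contMDiff.mdifferentiableAt (by simp))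

theorem mdifferentiableAt_inner_field_normal (hf : IsIsometricImmersion I I' f)
    (hξ : IsUnitNormal I I' f ξ) (hX : IsClosedConformal I' X) (p : M) :
    MDifferentiableAt I 𝓘(ℝ, ℝ) (fun r ↦ inner ℝ (X (f r)) (ξ r)) p :=
  mdifferentiableAt_inner_along (mdifferentiableAt_field_along hf hX p) (hξ.mdifferentiableAt p)

theorem mvfderiv_inner_field_normal [I.Boundaryless] [I'.Boundaryless]
    (hf : IsIsometricImmersion I I' f) (hξ : IsUnitNormal I I' f ξ)
    (hX : IsClosedConformal I' X)
    (hdim : Module.finrank ℝ E' = Module.finrank ℝ E + 1) {p : M}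
    (hp : tangentPart I' f ξ X p ≠ 0) (v : TangentSpace I p) :
    mvfderiv I (fun r ↦ inner ℝ (X (f r)) (ξ r)) p v
      = -(‖tangentPart I' f ξ X p‖
          * inner ℝ (shapeOperator I I' f ξ p (fieldT I I' f ξ X p)) v) := by
  have hfp : MDifferentiableAt I I' f p := hf.contMDiff.mdifferentiableAt (by simp)
  obtain ⟨φ, -, hφ⟩ := hX.2
  rw [mvfderiv_inner_along (mdifferentiableAt_field_along hf hX p) (hξ.mdifferentiableAt p),
    covDerivAlong_comp hfp (hX.mdifferentiableAt _), hφ, inner_smul_left, hξ.inner_eq_zero,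
    inner_shapeOperator, inner_covDerivAlong_normal_mfderiv_comm hf hξ, mfderiv_fieldT hf hξ hdim,
    inner_smul_right, real_inner_comm (tangentPart I' f ξ X p),
    inner_tangentPart_of_orthogonal ((real_inner_comm _ _).trans (inner_covDerivAlong_normal hξ p v))]
  have := norm_ne_zero_iff.2 hp
  field_simp
  simp

theorem mdifferentiableAt_inner_field_self (hf : IsIsometricImmersion I I' f)
    (hX : IsClosedConformal I' X) (p : M) :
    MDifferentiableAt I 𝓘(ℝ, ℝ) (fun r ↦ inner ℝ (X (f r)) (X (f r))) p :=
  mdifferentiableAt_inner_along (mdifferentiableAt_field_along hf hX p)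
    (mdifferentiableAt_field_along hf hX p)

theorem mvfderiv_inner_field_self (hf : IsIsometricImmersion I I' f)
    (hξ : IsUnitNormal I I' f ξ) (hX : IsClosedConformal I' X) {p : M}
    (hp : tangentPart I' f ξ X p ≠ 0) {v : TangentSpace I p}
    (hv : inner ℝ v (fieldT I I' f ξ X p) = 0) :
    mvfderiv I (fun r ↦ inner ℝ (X (f r)) (X (f r))) p v = 0 := by
  have hfp : MDifferentiableAt I I' f p := hf.contMDiff.mdifferentiableAt (by simp)
  obtain ⟨φ, -, hφ⟩ := hX.2
  rw [real_inner_comm, inner_fieldT hξ, mul_eq_zero, inv_eq_zero, norm_eq_zero] at hv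
  have h := hv.resolve_left hp
  rw [mvfderiv_inner_along (mdifferentiableAt_field_along hf hX p)
    (mdifferentiableAt_field_along hf hX p), covDerivAlong_comp hfp (hX.mdifferentiableAt _), hφ,
    inner_smul_left, inner_smul_right, h, real_inner_comm, h]
  simp

theorem mdifferentiableAt_norm_field_inv (hf : IsIsometricImmersion I I' f)
    (hX : IsClosedConformal I' X) {p : M} (hp : tangentPart I' f ξ X p ≠ 0) :
    MDifferentiableAt I 𝓘(ℝ, ℝ) (fun r ↦ ‖X (f r)‖⁻¹) p ∧
    ∀ v, mvfderiv I (fun r ↦ inner ℝ (X (f r)) (X (f r))) p v = 0 →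
      mvfderiv I (fun r ↦ ‖X (f r)‖⁻¹) p v = 0 := by
  have h0 : inner ℝ (X (f p)) (X (f p)) ≠ 0 := inner_self_ne_zero.2 (field_ne_zero hp)
  have h1 : (fun r ↦ ‖X (f r)‖⁻¹) = fun r ↦ (Real.sqrt (inner ℝ (X (f r)) (X (f r))))⁻¹ := by
    ext r
    rw [real_inner_self_eq_norm_sq, Real.sqrt_sq (norm_nonneg _)]
  have h2 := (Real.hasDerivAt_sqrt h0).inv
    (Real.sqrt_ne_zero'.2 (lt_of_le_of_ne real_inner_self_nonneg h0.symm))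
  have h3 := mdifferentiableAt_inner_field_self hf hX p
  rw [h1]
  refine ⟨MDifferentiableAt.comp p (g := fun x ↦ (Real.sqrt x)⁻¹)
    h2.differentiableAt.mdifferentiableAt h3, fun v hv ↦ ?_⟩
  rw [mvfderiv_comp_real (φ := fun x ↦ (Real.sqrt x)⁻¹) h3 h2, hv, mul_zero]

theorem mdifferentiableAt_cosAngle (hf : IsIsometricImmersion I I' f)
    (hξ : IsUnitNormal I I' f ξ) (hX : IsClosedConformal I' X) {p : M}
    (hp : tangentPart I' f ξ X p ≠ 0) :
    MDifferentiableAt I 𝓘(ℝ, ℝ) (cosAngle f ξ X) p :=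
  (mdifferentiableAt_inner_field_normal hf hξ hX p).mul (mdifferentiableAt_norm_field_inv hf hX hp).1

theorem mvfderiv_cosAngle (hf : IsIsometricImmersion I I' f)
    (hξ : IsUnitNormal I I' f ξ) (hX : IsClosedConformal I' X) {p : M}
    (hp : tangentPart I' f ξ X p ≠ 0) {v : TangentSpace I p}
    (hv : inner ℝ v (fieldT I I' f ξ X p) = 0) :
    mvfderiv I (cosAngle f ξ X) p v
      = ‖X (f p)‖⁻¹ * mvfderiv I (fun r ↦ inner ℝ (X (f r)) (ξ r)) p v := by
  have h := mdifferentiableAt_norm_field_inv hf hX hp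
  have h1 := mvfderiv_fun_mul (mdifferentiableAt_inner_field_normal hf hξ hX p) h.1
  refine (DFunLike.congr_fun h1 v).trans ?_
  simp [h.2 v (mvfderiv_inner_field_self hf hξ hX hp hv)]

theorem mvfderiv_cosAngle_eq_zero_iff [I.Boundaryless] [I'.Boundaryless]
    (hf : IsIsometricImmersion I I' f)
    (hξ : IsUnitNormal I I' f ξ) (hX : IsClosedConformal I' X)
    (hdim : Module.finrank ℝ E' = Module.finrank ℝ E + 1) {p : M}
    (hp : tangentPart I' f ξ X p ≠ 0) {v : TangentSpace I p}
    (hv : inner ℝ v (fieldT I I' f ξ X p) = 0) :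
    mvfderiv I (cosAngle f ξ X) p v = 0 ↔
      inner ℝ (shapeOperator I I' f ξ p (fieldT I I' f ξ X p)) v = 0 := by
  rw [mvfderiv_cosAngle hf hξ hX hp hv, mvfderiv_inner_field_normal hf hξ hX hdim hp]
  simp [field_ne_zero hp, hp]

theorem mvfderiv_angleXi (hf : IsIsometricImmersion I I' f)
    (hξ : IsUnitNormal I I' f ξ) (hX : IsClosedConformal I' X) {p : M}
    (hp : tangentPart I' f ξ X p ≠ 0) (v : TangentSpace I p) :
    mvfderiv I (angleXi I' f ξ X) p v = 0 ↔ mvfderiv I (cosAngle f ξ X) p v = 0 := by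
  have h := one_sub_cosAngle_sq_pos hξ hp
  have h1 : cosAngle f ξ X p ≠ -1 := fun h' ↦ by rw [h'] at h; norm_num at h
  have h2 : cosAngle f ξ X p ≠ 1 := fun h' ↦ by rw [h'] at h; norm_num at h
  rw [angleXi_eq_arccos hξ, mvfderiv_comp_real (mdifferentiableAt_cosAngle hf hξ hX hp)
    (Real.hasDerivAt_arccos h1 h2)]
  have := Real.sqrt_ne_zero'.2 h
  simp [this]

theorem exists_eq_smul_iff_forall_inner_eq_zero {V : Type*} [NormedAddCommGroup V]
    [InnerProductSpace ℝ V] (x y : V) :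
    (∃ c : ℝ, x = c • y) ↔ ∀ v, inner ℝ v y = 0 → inner ℝ x v = 0 := by
  constructor
  · rintro ⟨c, rfl⟩ v hv
    rw [inner_smul_left, real_inner_comm, hv, mul_zero]
  · intro h
    have : x ∈ (ℝ ∙ y)ᗮᗮ := by
      rw [Submodule.mem_orthogonal]
      intro u hu
      rw [real_inner_comm]
      exact h u ((Submodule.mem_orthogonal_singleton_iff_inner_left).1 hu)
    rw [Submodule.orthogonal_orthogonal, Submodule.mem_span_singleton] at this
    obtain ⟨c, hc⟩ := this
    exact ⟨c, hc.symm⟩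

theorem hasCanonicalPrincipalDirection_iff [I.Boundaryless] [I'.Boundaryless]
    (hf : IsIsometricImmersion I I' f)
    (hξ : IsUnitNormal I I' f ξ) (hX : IsClosedConformal I' X)
    (hdim : Module.finrank ℝ E' = Module.finrank ℝ E + 1)
    (hT : ∀ p, tangentPart I' f ξ X p ≠ 0) (S : Set M) :
    HasCanonicalPrincipalDirection I I' f ξ X S ↔
      ∀ p ∈ S, ∀ v : TangentSpace I p, inner ℝ v (fieldT I I' f ξ X p) = 0 →
        mvfderiv I (cosAngle f ξ X) p v = 0 := by
  refine forall₂_congr fun p _ ↦ ?_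
  rw [exists_eq_smul_iff_forall_inner_eq_zero]
  exact forall₂_congr fun v hv ↦ (mvfderiv_cosAngle_eq_zero_iff hf hξ hX hdim (hT p) hv).symm

theorem angleConstantOrthogonally_iff
    (hf : IsIsometricImmersion I I' f)
    (hξ : IsUnitNormal I I' f ξ) (hX : IsClosedConformal I' X)
    (hT : ∀ p, tangentPart I' f ξ X p ≠ 0) (S : Set M) :
    AngleConstantOrthogonally I I' f ξ X S ↔
      ∀ p ∈ S, ∀ v : TangentSpace I p, inner ℝ v (fieldT I I' f ξ X p) = 0 →
        mvfderiv I (cosAngle f ξ X) p v = 0 :=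
  forall₄_congr fun p _ v _ ↦ mvfderiv_angleXi hf hξ hX (hT p) v

end Pointwise

section LevelSetsStraightening

/-- A function with nonzero derivative is locally a coordinate. -/
theorem exists_straightening_normedSpace {E : Type*} [NormedAddCommGroup E] [NormedSpace ℝ E]
    [CompleteSpace E] {g : E → ℝ} {x : E} (hg : ContDiffAt ℝ 1 g x) (hd : fderiv ℝ g x ≠ 0) :
    ∃ (K : Submodule ℝ E) (Ψ : OpenPartialHomeomorph E (ℝ × K)), x ∈ Ψ.source ∧
      (∀ y ∈ Ψ.source, (Ψ y).1 = g y) ∧ (∀ y ∈ Ψ.source, DifferentiableAt ℝ Ψ y) ∧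
      ∀ z ∈ Ψ.target, DifferentiableAt ℝ Ψ.symm z := by
  set L := fderiv ℝ g x with hL
  obtain ⟨e, he⟩ : ∃ e, L e ≠ 0 := by
    by_contra! h
    exact hd (ContinuousLinearMap.ext h)
  let R : ℝ →L[ℝ] E := ContinuousLinearMap.toSpanSingleton ℝ ((L e)⁻¹ • e)
  have hR : Function.RightInverse R L := by
    intro t
    simp [R, he]
  let A : E ≃L[ℝ] ℝ × LinearMap.ker L.toLinearMap := ContinuousLinearEquiv.equivOfRightInverse L R hR
  have hA1 : ∀ y, (A y).1 = L y := fun y ↦ rfl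
  let ψ : E → ℝ × LinearMap.ker L.toLinearMap := fun y ↦ (g y, (A y).2)
  have hψ : ContDiffAt ℝ 1 ψ x := hg.prodMk (contDiff_snd.comp A.contDiff).contDiffAt
  have hψ' : HasFDerivAt ψ (A : E →L[ℝ] ℝ × LinearMap.ker L.toLinearMap) x := by
    have h1 : HasFDerivAt g L x := (hg.differentiableAt (by simp)).hasFDerivAt
    have h2 : HasFDerivAt (fun y ↦ (A y).2)
      ((ContinuousLinearMap.snd ℝ ℝ _).comp (A : E →L[ℝ] ℝ × LinearMap.ker L.toLinearMap)) x :=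
      ((ContinuousLinearMap.snd ℝ ℝ _).comp
        (A : E →L[ℝ] ℝ × LinearMap.ker L.toLinearMap)).hasFDerivAt
    exact h1.prodMk h2
  let Ψ := hψ.toOpenPartialHomeomorph ψ hψ' one_ne_zero
  have hx : x ∈ Ψ.source := hψ.mem_toOpenPartialHomeomorph_source hψ' one_ne_zero
  have hΨx : ContDiffAt ℝ 1 Ψ.symm (Ψ x) := hψ.to_localInverse hψ' one_ne_zero
  have e1 : ∀ᶠ y in 𝓝 x, ContDiffAt ℝ 1 Ψ y := hψ.eventually (by simp)
  have e2 : ∀ᶠ y in 𝓝 x, ContDiffAt ℝ 1 Ψ.symm (Ψ y) :=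
    (Ψ.continuousAt hx).eventually (hΨx.eventually (by simp))
  obtain ⟨V, hV, hVo, hxV⟩ := eventually_nhds_iff.1 (e1.and e2)
  refine ⟨_, Ψ.restrOpen V hVo, ⟨hx, hxV⟩, fun y _ ↦ rfl, fun y hy ↦ ?_, fun z hz ↦ ?_⟩
  · exact (hV y hy.2).1.differentiableAt (by simp)
  · have h := (Ψ.restrOpen V hVo).map_target hz
    have h1 := (hV _ h.2).2.differentiableAt (by simp)
    have h2 : Ψ ((Ψ.restrOpen V hVo).symm z) = z := (Ψ.restrOpen V hVo).right_inv hz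
    rw [h2] at h1
    exact h1

variable {E : Type*} [NormedAddCommGroup E] [NormedSpace ℝ E] [CompleteSpace E]
  {M : Type*} [TopologicalSpace M] [ChartedSpace E M] [IsManifold 𝓘(ℝ, E) ∞ M]

theorem exists_straightening {g : M → ℝ} {p : M}
    (hg : ContMDiffAt 𝓘(ℝ, E) 𝓘(ℝ, ℝ) 1 g p) (hd : mvfderiv 𝓘(ℝ, E) g p ≠ 0) :
    ∃ (K : Submodule ℝ E) (Ψ : OpenPartialHomeomorph M (ℝ × K)), p ∈ Ψ.source ∧
      (∀ q ∈ Ψ.source, (Ψ q).1 = g q) ∧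
      (∀ q ∈ Ψ.source, MDifferentiableAt 𝓘(ℝ, E) 𝓘(ℝ, ℝ × K) Ψ q) ∧
      ∀ z ∈ Ψ.target, MDifferentiableAt 𝓘(ℝ, ℝ × K) 𝓘(ℝ, E) Ψ.symm z := by
  have h1 := contDiffAt_comp_extChartAt_symm hg
  have h2 : fderiv ℝ (g ∘ (extChartAt 𝓘(ℝ, E) p).symm) (extChartAt 𝓘(ℝ, E) p p) ≠ 0 := by
    intro h0
    apply hd
    ext v
    rw [(eventually_mvfderiv_eq hg).self_of_nhds v, h0]
    rfl
  obtain ⟨K, Ψ, hx, hΨ1, hΨ2, hΨ3⟩ := exists_straightening_normedSpace h1 h2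
  refine ⟨K, (chartAt E p).trans Ψ, ?_, ?_, ?_, ?_⟩
  · rw [OpenPartialHomeomorph.trans_source]
    exact ⟨mem_chart_source E p, hx⟩
  · intro q hq
    rw [OpenPartialHomeomorph.trans_source] at hq
    have := hΨ1 _ hq.2
    refine this.trans ?_
    exact congr_arg g ((chartAt E p).left_inv hq.1)
  · intro q hq
    rw [OpenPartialHomeomorph.trans_source] at hq
    have h3 : MDifferentiableAt 𝓘(ℝ, E) 𝓘(ℝ, E) (extChartAt 𝓘(ℝ, E) p) q :=
      mdifferentiableAt_extChartAt hq.1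
    exact (hΨ2 _ hq.2).mdifferentiableAt.comp q h3
  · intro z hz
    rw [OpenPartialHomeomorph.trans_target] at hz
    have h3 : MDifferentiableAt 𝓘(ℝ, E) 𝓘(ℝ, E) (chartAt E p).symm (Ψ.symm z) :=
      mdifferentiableAt_atlas_symm (chart_mem_atlas E p) hz.2
    exact h3.comp z (hΨ3 z hz.1).mdifferentiableAt

/-- `k` is locally constant on the level sets of the restriction of `g` to `S`. -/
def LocallyConstantOnLevels {α : Type*} [TopologicalSpace α] (g k : α → ℝ) (S : Set α) : Prop :=
  ∀ p ∈ S, ∀ᶠ q in 𝓝 p, g q = g p → k q = k p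

theorem LocallyConstantOnLevels.eq_of_mem_connectedComponentIn {α : Type*} [TopologicalSpace α]
    {g k : α → ℝ} {S : Set α} (h : LocallyConstantOnLevels g k S) {p q : α}
    (hq : q ∈ connectedComponentIn (S ∩ g ⁻¹' {g p}) p) : k q = k p := by
  set C := connectedComponentIn (S ∩ g ⁻¹' {g p}) p with hC
  have hCS : C ⊆ S ∩ g ⁻¹' {g p} := connectedComponentIn_subset _ _
  have hpC : p ∈ C := mem_connectedComponentIn (connectedComponentIn_nonempty_iff.1 ⟨q, hq⟩)
  have hloc : IsLocallyConstant (fun x : C ↦ k x) := by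
    rw [IsLocallyConstant.iff_eventually_eq]
    intro x
    have h1 := continuous_subtype_val.continuousAt.eventually (h x (hCS x.2).1)
    filter_upwards [h1] with y hy
    exact hy ((hCS y.2).2.trans (hCS x.2).2.symm)
  have : PreconnectedSpace C :=
    Subtype.preconnectedSpace isPreconnected_connectedComponentIn
  exact hloc.apply_eq_of_isPreconnected isPreconnected_univ (mem_univ (⟨q, hq⟩ : C))
    (mem_univ (⟨p, hpC⟩ : C))

theorem eventually_mem_connectedComponentIn_level {g : M → ℝ} {S : Set M} (hS : IsOpen S) {p : M}
    (hp : p ∈ S) (hg : ContMDiffAt 𝓘(ℝ, E) 𝓘(ℝ, ℝ) 1 g p) (hd : mvfderiv 𝓘(ℝ, E) g p ≠ 0) :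
    ∀ᶠ q in 𝓝 p, g q = g p → q ∈ connectedComponentIn (S ∩ g ⁻¹' {g p}) p := by
  obtain ⟨K, Ψ, hpΨ, h1, -, -⟩ := exists_straightening hg hd
  have hV : IsOpen (Ψ.target ∩ Ψ.symm ⁻¹' S) := Ψ.symm.isOpen_inter_preimage hS
  obtain ⟨ε, hε, hball⟩ := Metric.isOpen_iff.1 hV (Ψ p)
    ⟨Ψ.map_source hpΨ, by simpa [Ψ.left_inv hpΨ] using hp⟩
  have e1 := (Ψ.continuousAt hpΨ).eventually (Metric.ball_mem_nhds (Ψ p) hε)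
  filter_upwards [e1, Ψ.open_source.mem_nhds hpΨ] with q hq hqs hgq
  have hconv : Convex ℝ (Metric.ball (Ψ p) ε ∩ {y | (ContinuousLinearMap.fst ℝ ℝ K) y = g p}) :=
    (convex_ball _ _).inter (convex_hyperplane (ContinuousLinearMap.fst ℝ ℝ K).isLinear _)
  have himg := hconv.isPreconnected.image Ψ.symm
    (Ψ.continuousOn_symm.mono fun y hy ↦ (hball hy.1).1)
  refine himg.subset_connectedComponentIn ?_ ?_ ?_
  · exact ⟨Ψ p, ⟨Metric.mem_ball_self hε, h1 p hpΨ⟩, Ψ.left_inv hpΨ⟩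
  · rintro _ ⟨y, hy, rfl⟩
    refine ⟨(hball hy.1).2, ?_⟩
    have h2 := h1 _ (Ψ.map_target (hball hy.1).1)
    rw [Ψ.right_inv (hball hy.1).1] at h2
    exact h2.symm.trans hy.2
  · exact ⟨Ψ q, ⟨hq, (h1 q hqs).trans hgq⟩, Ψ.left_inv hqs⟩

theorem forall_connectedComponentIn_iff_locallyConstantOnLevels {g k : M → ℝ} {S : Set M}
    (hS : IsOpen S) (hg : ∀ p ∈ S, ContMDiffAt 𝓘(ℝ, E) 𝓘(ℝ, ℝ) 1 g p)
    (hd : ∀ p ∈ S, mvfderiv 𝓘(ℝ, E) g p ≠ 0) :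
    (∀ p ∈ S, ∀ q ∈ connectedComponentIn (S ∩ g ⁻¹' {g p}) p, k q = k p) ↔
      LocallyConstantOnLevels g k S := by
  refine ⟨fun h p hp ↦ ?_, fun h p _ q hq ↦ h.eq_of_mem_connectedComponentIn hq⟩
  filter_upwards [eventually_mem_connectedComponentIn_level hS hp (hg p hp) (hd p hp)] with q hq hgq
  exact h p hp q (hq hgq)

theorem locallyConstantOnLevels_iff_mvfderiv {g k : M → ℝ} {S : Set M}
    (hS : IsOpen S) (hg : ∀ p ∈ S, ContMDiffAt 𝓘(ℝ, E) 𝓘(ℝ, ℝ) 1 g p)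
    (hd : ∀ p ∈ S, mvfderiv 𝓘(ℝ, E) g p ≠ 0)
    (hk : ∀ p ∈ S, MDifferentiableAt 𝓘(ℝ, E) 𝓘(ℝ, ℝ) k p) :
    LocallyConstantOnLevels g k S ↔ ∀ p ∈ S, ∀ v : TangentSpace 𝓘(ℝ, E) p,
      mvfderiv 𝓘(ℝ, E) g p v = 0 → mvfderiv 𝓘(ℝ, E) k p v = 0 := by
  constructor
  · intro h p hp v hv
    obtain ⟨K, Ψ, hpΨ, h1, h2, h3⟩ := exists_straightening (hg p hp) (hd p hp)
    have hpt := Ψ.map_source hpΨ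
    have hsymm : Ψ.symm (Ψ p) = p := Ψ.left_inv hpΨ
    let w : ℝ × K := mfderiv 𝓘(ℝ, E) 𝓘(ℝ, ℝ × K) Ψ p v
    have hw : w.1 = 0 := by
      have h4 := mvfderiv_clm_comp (ContinuousLinearMap.fst ℝ ℝ K) (h2 p hpΨ) v
      rw [mvfderiv_congr (g' := g)] at h4
      · exact h4.symm.trans hv
      · filter_upwards [Ψ.open_source.mem_nhds hpΨ] with q hq using h1 q hq
    have hk1 : MDifferentiableAt 𝓘(ℝ, E) 𝓘(ℝ, ℝ) k (Ψ.symm (Ψ p)) := by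
      rw [hsymm]; exact hk p hp
    have hκ : MDifferentiableAt 𝓘(ℝ, ℝ × K) 𝓘(ℝ, ℝ) (k ∘ Ψ.symm) (Ψ p) := hk1.comp _ (h3 _ hpt)
    have hcomp : mvfderiv 𝓘(ℝ, E) k p v = fderiv ℝ (k ∘ Ψ.symm) (Ψ p) w := by
      have h5 := mfderiv_comp_apply p hκ (h2 p hpΨ) v
      rw [mfderiv_eq_fderiv] at h5
      refine Eq.trans ?_ h5
      refine DFunLike.congr_fun (mvfderiv_congr (I := 𝓘(ℝ, E)) ?_) v
      filter_upwards [Ψ.open_source.mem_nhds hpΨ] with q hq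
      exact congr_arg k (Ψ.left_inv hq).symm
    have hline : HasDerivAt (fun t : ℝ ↦ Ψ p + t • w) w 0 := by
      simpa using ((hasDerivAt_id (0 : ℝ)).smul_const w).const_add (Ψ p)
    have hκ' : HasFDerivAt (k ∘ Ψ.symm) (fderiv ℝ (k ∘ Ψ.symm) (Ψ p)) (Ψ p + (0 : ℝ) • w) := by
      simpa using hκ.differentiableAt.hasFDerivAt
    have hder := hκ'.comp_hasDerivAt (0 : ℝ) hline
    have hconst : (k ∘ Ψ.symm) ∘ (fun t : ℝ ↦ Ψ p + t • w) =ᶠ[𝓝 0] fun _ ↦ k p := by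
      have hc : Filter.Tendsto (fun t : ℝ ↦ Ψ p + t • w) (𝓝 0) (𝓝 (Ψ p)) := by
        simpa using hline.continuousAt.tendsto
      have hc2 : Filter.Tendsto (fun t : ℝ ↦ Ψ.symm (Ψ p + t • w)) (𝓝 0) (𝓝 p) := by
        have := (Ψ.symm.continuousAt (x := Ψ p) hpt).tendsto.comp hc
        rwa [hsymm] at this
      filter_upwards [hc.eventually (Ψ.open_target.mem_nhds hpt), hc2.eventually (h p hp)]
        with t ht ht2
      apply ht2
      have h6 := h1 _ (Ψ.map_target ht)
      rw [Ψ.right_inv ht] at h6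
      rw [← h6, ← h1 p hpΨ]
      simp [hw]
    rw [hcomp]
    exact hder.unique ((hasDerivAt_const (0 : ℝ) (k p)).congr_of_eventuallyEq hconst)
  · intro h p hp
    obtain ⟨K, Ψ, hpΨ, h1, h2, h3⟩ := exists_straightening (hg p hp) (hd p hp)
    have hV : IsOpen (Ψ.target ∩ Ψ.symm ⁻¹' S) := Ψ.symm.isOpen_inter_preimage hS
    obtain ⟨ε, hε, hball⟩ := Metric.isOpen_iff.1 hV (Ψ p)
      ⟨Ψ.map_source hpΨ, by simpa [Ψ.left_inv hpΨ] using hp⟩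
    have hmem : ∀ w ∈ Metric.ball (Ψ p).2 ε, (g p, w) ∈ Metric.ball (Ψ p) ε := by
      intro w hw
      have : Ψ p = (g p, (Ψ p).2) := Prod.ext (h1 p hpΨ) rfl
      rw [this, Metric.mem_ball, Prod.dist_eq]
      simpa [hε] using hw
    have hder : ∀ w ∈ Metric.ball (Ψ p).2 ε,
        HasFDerivAt (fun w ↦ k (Ψ.symm (g p, w))) (0 : K →L[ℝ] ℝ) w := by
      intro w hw
      obtain ⟨hyt, hyS⟩ := hball (hmem w hw)
      have hκ : MDifferentiableAt 𝓘(ℝ, ℝ × K) 𝓘(ℝ, ℝ) (k ∘ Ψ.symm) (g p, w) :=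
        (hk _ hyS).comp _ (h3 _ hyt)
      have h4 := hκ.differentiableAt.hasFDerivAt.comp w
        (hasFDerivAt_prodMk_right (𝕜 := ℝ) (g p) w)
      convert! h4 using 1
      ext u
      have h5 := mfderiv_comp_apply (I := 𝓘(ℝ, ℝ × K)) (I' := 𝓘(ℝ, E)) (I'' := 𝓘(ℝ, ℝ))
        (g p, w) (hk _ hyS) (h3 _ hyt) ((0, u) : ℝ × K)
      rw [mfderiv_eq_fderiv] at h5
      refine Eq.symm (h5.trans (h _ hyS _ ?_))
      have h6 := mfderiv_comp_apply (I := 𝓘(ℝ, ℝ × K)) (I' := 𝓘(ℝ, E)) (I'' := 𝓘(ℝ, ℝ))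
        (g p, w) ((hg _ hyS).mdifferentiableAt (by simp)) (h3 _ hyt) ((0, u) : ℝ × K)
      refine h6.symm.trans ?_
      rw [mfderiv_eq_fderiv]
      have h7 : g ∘ Ψ.symm =ᶠ[𝓝 (g p, w)] (ContinuousLinearMap.fst ℝ ℝ K) := by
        filter_upwards [Ψ.open_target.mem_nhds hyt] with z hz
        have := h1 _ (Ψ.map_target hz)
        rw [Ψ.right_inv hz] at this
        exact this.symm
      rw [h7.fderiv_eq, ContinuousLinearMap.fderiv]
      rfl
    have e1 := (Ψ.continuousAt hpΨ).eventually (Metric.ball_mem_nhds (Ψ p) hε)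
    filter_upwards [e1, Ψ.open_source.mem_nhds hpΨ] with q hq hqs hgq
    have hq2 : (Ψ q).2 ∈ Metric.ball (Ψ p).2 ε := by
      rw [Prod.dist_eq] at hq
      exact (le_max_right _ _).trans_lt hq
    have hfin := Metric.isOpen_ball.is_const_of_fderiv_eq_zero (𝕜 := ℝ)
      (f := fun w ↦ k (Ψ.symm (g p, w))) (convex_ball (Ψ p).2 ε).isPreconnected
      (fun w hw ↦ (hder w hw).differentiableAt.differentiableWithinAt)
      (fun w hw ↦ (hder w hw).fderiv) hq2 (Metric.mem_ball_self hε)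
    have e3 : (g p, (Ψ q).2) = Ψ q := Prod.ext (hgq.symm.trans (h1 q hqs).symm) rfl
    have e4 : (g p, (Ψ p).2) = Ψ p := Prod.ext (h1 p hpΨ).symm rfl
    simp only [e3, e4, Ψ.left_inv hpΨ, Ψ.left_inv hqs] at hfin
    exact hfin

end LevelSetsStraightening

section Riesz

variable {E : Type*} [NormedAddCommGroup E] [NormedSpace ℝ E] [FiniteDimensional ℝ E]
  {H : Type*} [TopologicalSpace H] {I : ModelWithCorners ℝ E H}
  {M : Type*} [TopologicalSpace M] [ChartedSpace H M] [IsManifold I ∞ M]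
  [RiemannianBundle (fun x : M ↦ TangentSpace I x)]
  [IsContMDiffRiemannianBundle I ∞ E (fun x : M ↦ TangentSpace I x)]

/-- A vector field is smooth if its inner products with the coordinate fields are. -/
theorem contMDiffAt_of_inner_extend {Y : Π p : M, TangentSpace I p} {p : M}
    (h : ∀ v : TangentSpace I p,
      ContMDiffAt I 𝓘(ℝ, ℝ) ∞ (fun r ↦ inner ℝ (Y r) (FiberBundle.extend E v r)) p) :
    ContMDiffAt I I.tangent ∞ (fun r ↦ (⟨r, Y r⟩ : TangentBundle I M)) p := by
  refine (contMDiffAt_tangentCoord (f := fun r : M ↦ r)).2 ⟨contMDiffAt_id, ?_⟩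
  set e := trivializationAt E (TangentSpace I : M → Type _) p with he
  have hp : p ∈ e.baseSet := FiberBundle.mem_baseSet_trivializationAt' p
  let b := Module.finBasis ℝ E
  let s : Fin (Module.finrank ℝ E) → Π r : M, TangentSpace I r :=
    fun i ↦ FiberBundle.extend E (e.symm p (b i))
  have hs : ∀ i r, s i r = e.symm r (b i) := by
    intro i r
    simp only [s]
    rw [extend_eq_symm, tangentCoord_symm hp]
  have hss : ∀ i, ContMDiffAt I I.tangent ∞ (fun r ↦ (⟨r, s i r⟩ : TangentBundle I M)) p :=
    fun i ↦ FiberBundle.contMDiffAt_extend I E _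
  have hG : ∀ i j, ContMDiffAt I 𝓘(ℝ, ℝ) ∞ (fun r ↦ inner ℝ (s i r) (s j r)) p := fun i j ↦
    ContMDiffAt.inner_bundle (F := E) (E := fun x : M ↦ TangentSpace I x) (hss i) (hss j)
  let c : Fin (Module.finrank ℝ E) → E →L[ℝ] ℝ :=
    fun j ↦ LinearMap.toContinuousLinearMap (b.coord j)
  let β : M → E →L[ℝ] E := fun r ↦ ∑ i, ∑ j, inner ℝ (s j r) (s i r) • (c j).smulRight (b i)
  have hsum : ∀ r ∈ e.baseSet, ∀ x : E, e.symm r x = ∑ j, c j x • s j r := by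
    intro r hr x
    simp only [hs, ← Trivialization.symmL_apply (R := ℝ) _ hr]
    conv_lhs => rw [← b.sum_repr x, map_sum]
    simp only [map_smul]
    rfl
  have hβ : ∀ r ∈ e.baseSet, ∀ x : E, β r x = ∑ i, inner ℝ (e.symm r x) (s i r) • b i := by
    intro r hr x
    simp only [β, sum_apply, smul_apply, ContinuousLinearMap.smulRight_apply]
    refine Finset.sum_congr rfl fun i _ ↦ ?_
    rw [hsum r hr, sum_inner, Finset.sum_smul]
    refine Finset.sum_congr rfl fun j _ ↦ ?_
    rw [inner_smul_left, smul_smul, mul_comm]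
    rfl
  have hβs : ContMDiffAt I 𝓘(ℝ, E →L[ℝ] E) ∞ β p := by
    refine contMDiffAt_finsetSum fun i _ ↦ contMDiffAt_finsetSum fun j _ ↦ ?_
    exact (hG j i).smul contMDiffAt_const
  have hinj : Function.Injective (β p).toLinearMap := by
    rw [injective_iff_map_eq_zero]
    intro x hx
    have h1 : ∑ i, inner ℝ (e.symm p x) (s i p) • b i = 0 := (hβ p hp x).symm.trans hx
    have h2 : ∀ i, inner ℝ (e.symm p x) (s i p) = 0 :=
      Fintype.linearIndependent_iff.1 b.linearIndependent _ h1
    have h3 : inner ℝ (e.symm p x) (e.symm p x) = 0 := by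
      conv_lhs => arg 3; rw [hsum p hp]
      rw [inner_sum]
      refine Finset.sum_eq_zero fun j _ ↦ ?_
      rw [inner_smul_right, h2, mul_zero]
    have h4 := congr_arg (tangentCoord I p p) (inner_self_eq_zero.1 h3)
    rwa [tangentCoord_symm hp, map_zero] at h4
  let B : E ≃L[ℝ] E := (LinearEquiv.ofInjectiveEndo _ hinj).toContinuousLinearEquiv
  have hB : (B : E →L[ℝ] E) = β p := by
    ext x
    rfl
  have hinv : ContMDiffAt I 𝓘(ℝ, E →L[ℝ] E) ∞ (fun r ↦ (β r).inverse) p := by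
    have h1 : ContDiffAt ℝ ∞ ContinuousLinearMap.inverse (β p) := by
      rw [← hB]
      exact contDiffAt_map_inverse B
    exact h1.contMDiffAt.comp p hβs
  have hω : ContMDiffAt I 𝓘(ℝ, E) ∞ (fun r ↦ ∑ i, inner ℝ (Y r) (s i r) • b i) p := by
    refine contMDiffAt_finsetSum fun i _ ↦ ?_
    exact (h _).smul contMDiffAt_const
  refine (hinv.clm_apply hω).congr_of_eventuallyEq ?_
  have hopen : ∀ᶠ r in 𝓝 p, (β r).IsInvertible := by
    have := B.nhds
    rw [hB] at this
    exact hβs.continuousAt.eventually this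
  filter_upwards [hopen, eventually_mem_baseSet I p] with r hr hr2
  have h5 := hβ r hr2 (tangentCoord I p r (Y r))
  rw [symm_tangentCoord hr2] at h5
  rw [← h5]
  exact (hr.inverse_apply_eq.2 rfl).symm

end Riesz

section Geodesics

variable {E : Type*} [NormedAddCommGroup E] [NormedSpace ℝ E]
  {H : Type*} [TopologicalSpace H] {I : ModelWithCorners ℝ E H}
  {M : Type*} [TopologicalSpace M] [ChartedSpace H M]

theorem velocity_eq_of_isMIntegralCurveOn {T : Π p : M, TangentSpace I p} {γ : ℝ → M} {a b : ℝ}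
    (hγ : IsMIntegralCurveOn γ T (Ioo a b)) {t : ℝ} (ht : t ∈ Ioo a b) :
    MDifferentiableAt 𝓘(ℝ, ℝ) I γ t ∧ velocity I γ t = T (γ t) := by
  have h := (hγ t ht).hasMFDerivAt (isOpen_Ioo.mem_nhds ht)
  refine ⟨h.mdifferentiableAt, ?_⟩
  rw [velocity, h.mfderiv]
  exact one_smul ℝ (T (γ t))

variable [FiniteDimensional ℝ E] [I.Boundaryless] [IsManifold I ∞ M]
  [RiemannianBundle (fun x : M ↦ TangentSpace I x)]
  [IsContMDiffRiemannianBundle I ∞ E (fun x : M ↦ TangentSpace I x)]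

/-- The integral curves of `T` are geodesics if and only if `∇_T T = 0`. -/
theorem integralCurvesAreGeodesics_iff {T : Π p : M, TangentSpace I p} {S : Set M} (hS : IsOpen S)
    (hT : ∀ p ∈ S, ContMDiffAt I I.tangent ∞ (fun r ↦ (⟨r, T r⟩ : TangentBundle I M)) p) :
    IntegralCurvesAreGeodesics I T S ↔ ∀ p ∈ S, leviCivita I M T p (T p) = 0 := by
  have key : ∀ (γ : ℝ → M) (a b : ℝ), (∀ t ∈ Ioo a b, γ t ∈ S) → IsMIntegralCurveOn γ T (Ioo a b) →
      ∀ t ∈ Ioo a b, covDerivAlong I 𝓘(ℝ, ℝ) γ (velocity I γ) t (1 : ℝ)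
        = leviCivita I M T (γ t) (T (γ t)) := by
    intro γ a b hγS hγ t ht
    have h1 : ∀ᶠ r in 𝓝 t, velocity I γ r = T (γ r) := by
      filter_upwards [isOpen_Ioo.mem_nhds ht] with r hr
      exact (velocity_eq_of_isMIntegralCurveOn hγ hr).2
    refine (covDerivAlong_congr h1 _).trans ((covDerivAlong_comp
      (velocity_eq_of_isMIntegralCurveOn hγ ht).1
      ((hT _ (hγS t ht)).mdifferentiableAt (by simp)) _).trans ?_)
    exact congr_arg _ (velocity_eq_of_isMIntegralCurveOn hγ ht).2
  constructor
  · intro h p hp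
    obtain ⟨γ, hγ0, hγ⟩ := exists_isMIntegralCurveAt_of_contMDiffAt_boundaryless (0 : ℝ)
      ((hT p hp).of_le ENat.LEInfty.out)
    have h1 : ∀ᶠ t in 𝓝 (0 : ℝ), γ t ∈ S :=
      hγ.continuousAt.eventually (by rw [hγ0]; exact hS.mem_nhds hp)
    obtain ⟨ε, hε, hball⟩ := Metric.eventually_nhds_iff_ball.1 (h1.and hγ)
    have hI : Ioo (-ε) ε = Metric.ball (0 : ℝ) ε := by rw [Real.ball_eq_Ioo]; simp
    have hγS : ∀ t ∈ Ioo (-ε) ε, γ t ∈ S := fun t ht ↦ (hball t (hI ▸ ht)).1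
    have hγI : IsMIntegralCurveOn γ T (Ioo (-ε) ε) :=
      fun t ht ↦ (hball t (hI ▸ ht)).2.hasMFDerivWithinAt
    have h0 : (0 : ℝ) ∈ Ioo (-ε) ε := ⟨by linarith, hε⟩
    have h2 := (h γ _ _ hγS hγI).covDerivAlong_velocity 0 h0
    rw [key γ _ _ hγS hγI 0 h0] at h2
    subst hγ0
    exact h2
  · intro h γ a b hγS hγ
    refine ⟨fun t ht ↦ (velocity_eq_of_isMIntegralCurveOn hγ ht).1, fun t ht ↦ ?_, fun t ht ↦ ?_⟩
    · have h1 : MDifferentiableAt 𝓘(ℝ, ℝ) I.tangent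
          (fun r ↦ (⟨γ r, T (γ r)⟩ : TangentBundle I M)) t :=
        ((hT _ (hγS t ht)).mdifferentiableAt (by simp)).comp t
          (velocity_eq_of_isMIntegralCurveOn hγ ht).1
      refine h1.congr_of_eventuallyEq ?_
      filter_upwards [isOpen_Ioo.mem_nhds ht] with r hr
      rw [(velocity_eq_of_isMIntegralCurveOn hγ hr).2]
    · rw [key γ a b hγS hγ t ht]
      exact h _ (hγS t ht)

end Geodesics

section FieldT

variable {E : Type*} [NormedAddCommGroup E] [NormedSpace ℝ E] [FiniteDimensional ℝ E]
  {H : Type*} [TopologicalSpace H] {I : ModelWithCorners ℝ E H}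
  {M : Type*} [TopologicalSpace M] [ChartedSpace H M] [IsManifold I ∞ M]
  [RiemannianBundle (fun x : M ↦ TangentSpace I x)]
  [IsContMDiffRiemannianBundle I ∞ E (fun x : M ↦ TangentSpace I x)]
  {E' : Type*} [NormedAddCommGroup E'] [NormedSpace ℝ E'] [FiniteDimensional ℝ E']
  {H' : Type*} [TopologicalSpace H'] {I' : ModelWithCorners ℝ E' H'}
  {Q : Type*} [TopologicalSpace Q] [ChartedSpace H' Q] [IsManifold I' ∞ Q]
  [RiemannianBundle (fun x : Q ↦ TangentSpace I' x)]
  [IsContMDiffRiemannianBundle I' ∞ E' (fun x : Q ↦ TangentSpace I' x)]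
  {f : M → Q} {ξ : Π p : M, TangentSpace I' (f p)} {X : Π q : Q, TangentSpace I' q}

set_option linter.unusedSectionVars false

theorem norm_tangentPart_inv (hξ : IsUnitNormal I I' f ξ) :
    (fun p ↦ ‖tangentPart I' f ξ X p‖⁻¹) = fun p ↦ (Real.sqrt
      (inner ℝ (X (f p)) (X (f p)) - inner ℝ (X (f p)) (ξ p) ^ 2))⁻¹ := by
  ext p
  rw [← norm_tangentPart_sq hξ, Real.sqrt_sq (norm_nonneg _)]

theorem contMDiffAt_norm_tangentPart_inv (hf : IsIsometricImmersion I I' f)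
    (hξ : IsUnitNormal I I' f ξ) (hX : IsClosedConformal I' X) {p : M}
    (hp : tangentPart I' f ξ X p ≠ 0) :
    ContMDiffAt I 𝓘(ℝ, ℝ) ∞ (fun p ↦ ‖tangentPart I' f ξ X p‖⁻¹) p := by
  have hXf : ContMDiffAt I I'.tangent ∞ (fun r ↦ (⟨f r, X (f r)⟩ : TangentBundle I' Q)) p :=
    (hX.1.contMDiffAt (x := f p)).comp p hf.contMDiff.contMDiffAt
  have h1 : ContMDiffAt I 𝓘(ℝ, ℝ) ∞ (fun r ↦ inner ℝ (X (f r)) (X (f r))) p :=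
    ContMDiffAt.inner_bundle (F := E') (E := fun x : Q ↦ TangentSpace I' x) hXf hXf
  have h2 : ContMDiffAt I 𝓘(ℝ, ℝ) ∞ (fun r ↦ inner ℝ (X (f r)) (ξ r)) p :=
    ContMDiffAt.inner_bundle (F := E') (E := fun x : Q ↦ TangentSpace I' x) hXf
      hξ.contMDiff.contMDiffAt
  have h3 : 0 < inner ℝ (X (f p)) (X (f p)) - inner ℝ (X (f p)) (ξ p) ^ 2 := by
    rw [← norm_tangentPart_sq hξ]
    have := norm_pos_iff.2 hp
    positivity
  rw [norm_tangentPart_inv hξ]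
  have h4 : ContDiffAt ℝ ∞ (fun x : ℝ ↦ (Real.sqrt x)⁻¹)
      (inner ℝ (X (f p)) (X (f p)) - inner ℝ (X (f p)) (ξ p) ^ 2) :=
    (Real.contDiffAt_sqrt h3.ne').inv (Real.sqrt_ne_zero'.2 h3)
  exact ContMDiffAt.comp p (g := fun x : ℝ ↦ (Real.sqrt x)⁻¹)
    (f := fun r ↦ inner ℝ (X (f r)) (X (f r)) - inner ℝ (X (f r)) (ξ r) ^ 2)
    h4.contMDiffAt (h1.sub (h2.pow 2))

theorem contMDiffAt_inner_field_mfderiv_extend (hf : IsIsometricImmersion I I' f)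
    (hX : IsClosedConformal I' X) (p : M) (v : TangentSpace I p) :
    ContMDiffAt I 𝓘(ℝ, ℝ) ∞
      (fun r ↦ inner ℝ (X (f r)) (mfderiv I I' f r (FiberBundle.extend E v r))) p :=
  ContMDiffAt.inner_bundle (F := E') (E := fun x : Q ↦ TangentSpace I' x)
    ((hX.1.contMDiffAt (x := f p)).comp p hf.contMDiff.contMDiffAt)
    (contMDiffAt_mfderiv_extend hf.contMDiff p v)

theorem contMDiffAt_fieldT (hf : IsIsometricImmersion I I' f)
    (hξ : IsUnitNormal I I' f ξ) (hX : IsClosedConformal I' X) {p : M}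
    (hp : tangentPart I' f ξ X p ≠ 0) :
    ContMDiffAt I I.tangent ∞ (fun r ↦ (⟨r, fieldT I I' f ξ X r⟩ : TangentBundle I M)) p := by
  refine contMDiffAt_of_inner_extend fun v ↦ ?_
  simp only [inner_fieldT hξ]
  exact (contMDiffAt_norm_tangentPart_inv hf hξ hX hp).mul
    (contMDiffAt_inner_field_mfderiv_extend hf hX p v)

theorem mvfderiv_norm_tangentPart_inv_eq_zero_iff (hf : IsIsometricImmersion I I' f)
    (hξ : IsUnitNormal I I' f ξ) (hX : IsClosedConformal I' X) {p : M}
    (hp : tangentPart I' f ξ X p ≠ 0) (hc : cosAngle f ξ X p ≠ 0) {v : TangentSpace I p}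
    (hv : inner ℝ v (fieldT I I' f ξ X p) = 0) :
    mvfderiv I (fun p ↦ ‖tangentPart I' f ξ X p‖⁻¹) p v = 0 ↔
      mvfderiv I (cosAngle f ξ X) p v = 0 := by
  have h1 := mdifferentiableAt_inner_field_self hf hX p
  have h2 := mdifferentiableAt_inner_field_normal hf hξ hX p
  have h22 : MDifferentiableAt I 𝓘(ℝ, ℝ) (fun r ↦ inner ℝ (X (f r)) (ξ r) ^ 2) p := h2.pow 2
  have h12 : MDifferentiableAt I 𝓘(ℝ, ℝ)
    (fun r ↦ inner ℝ (X (f r)) (X (f r)) - inner ℝ (X (f r)) (ξ r) ^ 2) p := h1.sub h22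
  have h3 : 0 < inner ℝ (X (f p)) (X (f p)) - inner ℝ (X (f p)) (ξ p) ^ 2 := by
    rw [← norm_tangentPart_sq hξ]
    have := norm_pos_iff.2 hp
    positivity
  have h4 := (Real.hasDerivAt_sqrt h3.ne').inv (Real.sqrt_ne_zero'.2 h3)
  have hc' : inner ℝ (X (f p)) (ξ p) ≠ 0 := fun h ↦ hc (by rw [cosAngle, h, zero_mul])
  have h5 := mvfderiv_comp_real (φ := fun x ↦ x ^ 2) h2 (hasDerivAt_pow 2 _) v
  rw [norm_tangentPart_inv hξ, mvfderiv_comp_real (φ := fun x ↦ (Real.sqrt x)⁻¹) h12 h4,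
    mvfderiv_fun_sub h1 h22, sub_apply, mvfderiv_inner_field_self hf hξ hX hp hv, h5,
    mvfderiv_cosAngle hf hξ hX hp hv]
  have h6 := (Real.sqrt_pos.2 h3).ne'
  set s := Real.sqrt (inner ℝ (X (f p)) (X (f p)) - inner ℝ (X (f p)) (ξ p) ^ 2)
  simp [h6, hc', field_ne_zero hp]

theorem leviCivita_fieldT_fieldT_eq_zero_iff [I.Boundaryless] [I'.Boundaryless]
    (hf : IsIsometricImmersion I I' f)
    (hξ : IsUnitNormal I I' f ξ) (hX : IsClosedConformal I' X)
    (hdim : Module.finrank ℝ E' = Module.finrank ℝ E + 1)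
    (hT : ∀ p, tangentPart I' f ξ X p ≠ 0) {p : M} (hc : cosAngle f ξ X p ≠ 0) :
    leviCivita I M (fieldT I I' f ξ X) p (fieldT I I' f ξ X p) = 0 ↔
      ∀ v : TangentSpace I p, inner ℝ v (fieldT I I' f ξ X p) = 0 →
        mvfderiv I (cosAngle f ξ X) p v = 0 := by
  set T := fieldT I I' f ξ X with hT_def
  have hTs : MDiffAt (T% T) p := (contMDiffAt_fieldT hf hξ hX (hT p)).mdifferentiableAt (by simp)
  have hfp : MDifferentiableAt I I' f p := hf.contMDiff.mdifferentiableAt (by simp)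
  have hT0 := norm_ne_zero_iff.2 (hT p)
  -- `⟨∇_v T, T⟩ = 0`
  have hunit : ∀ v, inner ℝ (leviCivita I M T p v) (T p) = 0 := by
    intro v
    have h := mvfderiv_inner_leviCivita (FiberBundle.mdifferentiableAt_extend I E v) hTs hTs
    have h1 : (fun r ↦ inner ℝ (T r) (T r)) = fun _ ↦ (1 : ℝ) := by
      ext r
      exact inner_fieldT_self hf hξ hdim (hT r)
    rw [h1, mvfderiv_const] at h
    simp only [zero_apply, FiberBundle.extend_apply_self] at h
    rw [real_inner_comm _ (T p)] at h
    linarith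
  set α : TangentSpace I p → M → ℝ :=
    fun w r ↦ inner ℝ (X (f r)) (mfderiv I I' f r (FiberBundle.extend E w r)) with hα
  have hαd : ∀ w, MDifferentiableAt I 𝓘(ℝ, ℝ) (α w) p := fun w ↦
    (contMDiffAt_inner_field_mfderiv_extend hf hX p w).mdifferentiableAt (by simp)
  have hαc : ∀ v w, mvfderiv I (α w) p v = mvfderiv I (α v) p w := by
    have key : ∀ v w, mvfderiv I (α w) p v = _ := fun v w ↦
      mvfderiv_inner_along (mdifferentiableAt_field_along hf hX p)
        ((contMDiffAt_mfderiv_extend hf.contMDiff p w).mdifferentiableAt (by simp)) v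
    intro v w
    obtain ⟨φ, -, hφ⟩ := hX.2
    rw [key v w, key w v, covDerivAlong_mfderiv_extend_comm hf.contMDiff,
      covDerivAlong_comp hfp (hX.mdifferentiableAt _), covDerivAlong_comp hfp
      (hX.mdifferentiableAt _), hφ, hφ, inner_smul_left, inner_smul_left]
    simp only [FiberBundle.extend_apply_self]
    rw [real_inner_comm (mfderiv I I' f p v)]
  set ρ : M → ℝ := fun r ↦ ‖tangentPart I' f ξ X r‖⁻¹ with hρ
  have hρd : MDifferentiableAt I 𝓘(ℝ, ℝ) ρ p :=
    (contMDiffAt_norm_tangentPart_inv hf hξ hX (hT p)).mdifferentiableAt (by simp)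
  have hder : ∀ v w, ρ p * mvfderiv I (α w) p v + α w p * mvfderiv I ρ p v
      = inner ℝ (leviCivita I M T p v) w
        + inner ℝ (T p) (leviCivita I M (FiberBundle.extend E w) p v) := by
    intro v w
    have h := mvfderiv_inner_leviCivita (FiberBundle.mdifferentiableAt_extend I E v) hTs
      (FiberBundle.mdifferentiableAt_extend I E w)
    simp only [FiberBundle.extend_apply_self] at h
    rw [← h]
    have h1 : (fun r ↦ inner ℝ (T r) (FiberBundle.extend E w r)) = fun r ↦ ρ r * α w r := by
      ext r
      exact inner_fieldT hξ r _
    rw [h1, mvfderiv_fun_mul hρd (hαd w)]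
    rfl
  have hαw : ∀ w, α w p = ‖tangentPart I' f ξ X p‖ * inner ℝ (T p) w := by
    intro w
    rw [hT_def, inner_fieldT hξ, ← mul_assoc, mul_inv_cancel₀ hT0, one_mul]
    simp only [hα, FiberBundle.extend_apply_self]
  have main : ∀ w, inner ℝ w (T p) = 0 →
      inner ℝ (leviCivita I M T p (T p)) w
        = -(‖tangentPart I' f ξ X p‖ * mvfderiv I ρ p w) := by
    intro w hw
    have h1 := hder (T p) w
    have h2 := hder w (T p)
    rw [hαw w, real_inner_comm, hw] at h1
    rw [hαw (T p), inner_fieldT_self hf hξ hdim (hT p), hunit, ← hαc] at h2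
    rw [leviCivita_extend_comm] at h1
    linarith
  have hfin : leviCivita I M T p (T p) = 0 ↔
      ∀ w, inner ℝ w (T p) = 0 → inner ℝ (leviCivita I M T p (T p)) w = 0 := by
    refine ⟨fun h w _ ↦ by rw [h, inner_zero_left], fun h ↦ ?_⟩
    have h1 := h _ (hunit (T p))
    exact inner_self_eq_zero.1 h1
  rw [hfin]
  refine forall₂_congr fun w hw ↦ ?_
  rw [main w hw, neg_eq_zero, mul_eq_zero, or_iff_right hT0]
  exact mvfderiv_norm_tangentPart_inv_eq_zero_iff hf hξ hX (hT p) hc hw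

end FieldT

section Gradient

variable {E : Type*} [NormedAddCommGroup E] [NormedSpace ℝ E] [FiniteDimensional ℝ E]
  {H : Type*} [TopologicalSpace H] {I : ModelWithCorners ℝ E H}
  {M : Type*} [TopologicalSpace M] [ChartedSpace H M]
  [RiemannianBundle (fun x : M ↦ TangentSpace I x)]

theorem inner_gradient (g : M → ℝ) (p : M) (v : TangentSpace I p) :
    inner ℝ (gradient I g p) v = mvfderiv I g p v := by
  rw [gradient]
  exact InnerProductSpace.toDual_symm_apply

theorem mvfderiv_ne_zero_of_gradient {g : M → ℝ} {p : M} (h : gradient I g p ≠ 0) :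
    mvfderiv I g p ≠ 0 := by
  intro h0
  have := inner_gradient g p (gradient I g p)
  rw [h0] at this
  exact h (inner_self_eq_zero.1 this)

end Gradient

section WarpedChart

variable {E : Type*} [NormedAddCommGroup E] [NormedSpace ℝ E]
  {H : Type*} [TopologicalSpace H] {I : ModelWithCorners ℝ E H}
  {N : Type*} [TopologicalSpace N] [ChartedSpace H N]
  [RiemannianBundle (fun x : N ↦ TangentSpace I x)]
  {E' : Type*} [NormedAddCommGroup E'] [NormedSpace ℝ E']
  {H' : Type*} [TopologicalSpace H'] {I' : ModelWithCorners ℝ E' H'}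
  {Q : Type*} [TopologicalSpace Q] [ChartedSpace H' Q]
  [RiemannianBundle (fun x : Q ↦ TangentSpace I' x)]
  {X : Π q : Q, TangentSpace I' q} {J : Set ℝ} {ϱ : ℝ → ℝ} {Φ : OpenPartialHomeomorph Q (ℝ × N)}

theorem IsWarpedProductChart.mem_interval (hΦ : IsWarpedProductChart I I' X J ϱ Φ) {q : Q}
    (hq : q ∈ Φ.source) : (Φ q).1 ∈ J := by
  have h := Φ.map_source hq
  rw [hΦ.target_eq] at h
  exact h.1

theorem IsWarpedProductChart.contMDiffAt (hΦ : IsWarpedProductChart I I' X J ϱ Φ) {q : Q}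
    (hq : q ∈ Φ.source) : ContMDiffAt I' (𝓘(ℝ, ℝ).prod I) ∞ Φ q :=
  hΦ.contMDiffOn.contMDiffAt (Φ.open_source.mem_nhds hq)

theorem IsWarpedProductChart.inner_field (hΦ : IsWarpedProductChart I I' X J ϱ Φ) {q : Q}
    (hq : q ∈ Φ.source) (u : TangentSpace I' q) :
    inner ℝ u (X q) = ϱ (Φ q).1 *
      (mfderiv I' (𝓘(ℝ, ℝ).prod I) Φ q u : TangentSpace (𝓘(ℝ, ℝ).prod I) (Φ q)).1 := by
  rw [hΦ.inner_eq q hq, hΦ.map_field q hq]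
  have : @inner ℝ (TangentSpace I (Φ q).2) _
      (mfderiv I' (𝓘(ℝ, ℝ).prod I) Φ q u : TangentSpace (𝓘(ℝ, ℝ).prod I) (Φ q)).2 (0 : E) = 0 :=
    inner_zero_right (𝕜 := ℝ) (E := TangentSpace I (Φ q).2) _
  simp only [warpedInner]
  rw [this, mul_zero, add_zero, mul_comm]

theorem IsWarpedProductChart.norm_field (hΦ : IsWarpedProductChart I I' X J ϱ Φ) {q : Q}
    (hq : q ∈ Φ.source) : ‖X q‖ = ϱ (Φ q).1 := by
  have h := hΦ.inner_field hq (X q)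
  rw [hΦ.map_field q hq, real_inner_self_eq_norm_sq] at h
  have h1 := (hΦ.warping_pos _ (hΦ.mem_interval hq)).le
  refine (sq_eq_sq₀ (norm_nonneg _) h1).1 (h.trans ?_)
  exact (sq _).symm

theorem IsWarpedProductChart.mvfderiv_fst (hΦ : IsWarpedProductChart I I' X J ϱ Φ) {q : Q}
    (hq : q ∈ Φ.source) (u : TangentSpace I' q) :
    mvfderiv I' (fun q ↦ (Φ q).1) q u = ‖X q‖⁻¹ * inner ℝ (X q) u := by
  have h0 := (hΦ.warping_pos _ (hΦ.mem_interval hq)).ne'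
  have h1 := mfderiv_comp_apply (I := I') (I' := 𝓘(ℝ, ℝ).prod I) (I'' := 𝓘(ℝ, ℝ)) q
    (g := Prod.fst) (f := Φ) mdifferentiableAt_fst ((hΦ.contMDiffAt hq).mdifferentiableAt (by simp)) u
  rw [mfderiv_fst] at h1
  refine h1.trans ?_
  rw [real_inner_comm, hΦ.inner_field hq, hΦ.norm_field hq, inv_mul_cancel_left₀ h0]
  rfl

end WarpedChart

section Height

variable {E : Type*} [NormedAddCommGroup E] [NormedSpace ℝ E] [FiniteDimensional ℝ E]
  {H : Type*} [TopologicalSpace H] {I : ModelWithCorners ℝ E H}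
  {M : Type*} [TopologicalSpace M] [ChartedSpace H M] [IsManifold I ∞ M]
  [RiemannianBundle (fun x : M ↦ TangentSpace I x)]
  [IsContMDiffRiemannianBundle I ∞ E (fun x : M ↦ TangentSpace I x)]
  {E' : Type*} [NormedAddCommGroup E'] [NormedSpace ℝ E'] [FiniteDimensional ℝ E']
  {H' : Type*} [TopologicalSpace H'] {I' : ModelWithCorners ℝ E' H'}
  {Q : Type*} [TopologicalSpace Q] [ChartedSpace H' Q] [IsManifold I' ∞ Q]
  [RiemannianBundle (fun x : Q ↦ TangentSpace I' x)]
  [IsContMDiffRiemannianBundle I' ∞ E' (fun x : Q ↦ TangentSpace I' x)]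
  {f : M → Q} {ξ : Π p : M, TangentSpace I' (f p)} {X : Π q : Q, TangentSpace I' q}
  {E₀ : Type*} [NormedAddCommGroup E₀] [NormedSpace ℝ E₀]
  {H₀ : Type*} [TopologicalSpace H₀] {I₀ : ModelWithCorners ℝ E₀ H₀}
  {N : Type*} [TopologicalSpace N] [ChartedSpace H₀ N]
  [RiemannianBundle (fun x : N ↦ TangentSpace I₀ x)]
  {J : Set ℝ} {ϱ : ℝ → ℝ} {Φ : OpenPartialHomeomorph Q (ℝ × N)}

set_option linter.unusedSectionVars false

theorem contMDiffAt_chart_comp (hf : IsIsometricImmersion I I' f)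
    (hΦ : IsWarpedProductChart I₀ I' X J ϱ Φ) {p : M} (hp : f p ∈ Φ.source) :
    ContMDiffAt I (𝓘(ℝ, ℝ).prod I₀) ∞ (fun r ↦ Φ (f r)) p :=
  (hΦ.contMDiffAt hp).comp p hf.contMDiff.contMDiffAt

theorem contMDiffAt_height (hf : IsIsometricImmersion I I' f)
    (hΦ : IsWarpedProductChart I₀ I' X J ϱ Φ) {p : M} (hp : f p ∈ Φ.source) :
    ContMDiffAt I 𝓘(ℝ, ℝ) ∞ (fun r ↦ (Φ (f r)).1) p :=
  contMDiffAt_fst.comp p (contMDiffAt_chart_comp hf hΦ hp)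

theorem gradient_height (hf : IsIsometricImmersion I I' f) (hξ : IsUnitNormal I I' f ξ)
    (hΦ : IsWarpedProductChart I₀ I' X J ϱ Φ) {p : M} (hp : f p ∈ Φ.source)
    (hT : tangentPart I' f ξ X p ≠ 0) :
    gradient I (fun r ↦ (Φ (f r)).1) p
      = (‖tangentPart I' f ξ X p‖ * ‖X (f p)‖⁻¹) • fieldT I I' f ξ X p := by
  refine ext_inner_right ℝ fun v ↦ ?_
  have h1 : MDifferentiableAt I' 𝓘(ℝ, ℝ) (fun q ↦ (Φ q).1) (f p) :=
    (contMDiffAt_fst.comp (f p) (hΦ.contMDiffAt hp)).mdifferentiableAt (by simp)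
  have h2 := mfderiv_comp_apply p (g := fun q ↦ (Φ q).1) (f := f) h1
    (hf.contMDiff.mdifferentiableAt (by simp)) v
  have h3 : mvfderiv I (fun r ↦ (Φ (f r)).1) p v = _ := h2.trans (hΦ.mvfderiv_fst hp _)
  rw [inner_gradient, h3, inner_smul_left, inner_fieldT hξ, conj_trivial]
  have := norm_ne_zero_iff.2 hT
  field_simp

theorem norm_gradient_height (hf : IsIsometricImmersion I I' f) (hξ : IsUnitNormal I I' f ξ)
    (hdim : Module.finrank ℝ E' = Module.finrank ℝ E + 1)
    (hΦ : IsWarpedProductChart I₀ I' X J ϱ Φ) {p : M} (hp : f p ∈ Φ.source)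
    (hT : tangentPart I' f ξ X p ≠ 0) :
    ‖gradient I (fun r ↦ (Φ (f r)).1) p‖ = Real.sqrt (1 - cosAngle f ξ X p ^ 2) := by
  have h1 : ‖fieldT I I' f ξ X p‖ = 1 := by
    have := inner_fieldT_self hf hξ hdim hT
    rw [real_inner_self_eq_norm_sq] at this
    exact (pow_eq_one_iff_of_nonneg (norm_nonneg _) two_ne_zero).1 this
  rw [gradient_height hf hξ hΦ hp hT, norm_smul, h1, mul_one, one_sub_cosAngle_sq hξ hT,
    Real.sqrt_sq (by positivity), Real.norm_of_nonneg (by positivity)]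

theorem gradient_height_ne_zero (hf : IsIsometricImmersion I I' f) (hξ : IsUnitNormal I I' f ξ)
    (hdim : Module.finrank ℝ E' = Module.finrank ℝ E + 1)
    (hΦ : IsWarpedProductChart I₀ I' X J ϱ Φ) {p : M} (hp : f p ∈ Φ.source)
    (hT : tangentPart I' f ξ X p ≠ 0) :
    gradient I (fun r ↦ (Φ (f r)).1) p ≠ 0 := by
  rw [← norm_ne_zero_iff, norm_gradient_height hf hξ hdim hΦ hp hT]
  exact Real.sqrt_ne_zero'.2 (one_sub_cosAngle_sq_pos hξ hT)

theorem mvfderiv_height_eq_zero_iff (hf : IsIsometricImmersion I I' f)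
    (hξ : IsUnitNormal I I' f ξ)
    (hΦ : IsWarpedProductChart I₀ I' X J ϱ Φ) {p : M} (hp : f p ∈ Φ.source)
    (hT : tangentPart I' f ξ X p ≠ 0) (v : TangentSpace I p) :
    mvfderiv I (fun r ↦ (Φ (f r)).1) p v = 0 ↔ inner ℝ v (fieldT I I' f ξ X p) = 0 := by
  rw [← inner_gradient, gradient_height hf hξ hΦ hp hT, inner_smul_left, real_inner_comm]
  simp [hT, field_ne_zero hT]

theorem mvfderiv_norm_gradient_height (hf : IsIsometricImmersion I I' f)
    (hξ : IsUnitNormal I I' f ξ) (hX : IsClosedConformal I' X)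
    (hdim : Module.finrank ℝ E' = Module.finrank ℝ E + 1)
    (hΦ : IsWarpedProductChart I₀ I' X J ϱ Φ) {p : M} (hp : f p ∈ Φ.source)
    (hT : ∀ p, tangentPart I' f ξ X p ≠ 0) (hc : cosAngle f ξ X p ≠ 0) :
    MDifferentiableAt I 𝓘(ℝ, ℝ) (fun r ↦ ‖gradient I (fun r ↦ (Φ (f r)).1) r‖) p ∧
    ∀ v, mvfderiv I (fun r ↦ ‖gradient I (fun r ↦ (Φ (f r)).1) r‖) p v = 0 ↔
      mvfderiv I (cosAngle f ξ X) p v = 0 := by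
  have heq : (fun r ↦ ‖gradient I (fun r ↦ (Φ (f r)).1) r‖) =ᶠ[𝓝 p]
      fun r ↦ Real.sqrt (1 - cosAngle f ξ X r ^ 2) := by
    filter_upwards [hf.contMDiff.continuous.continuousAt.eventually (Φ.open_source.mem_nhds hp)]
      with r hr
    exact norm_gradient_height hf hξ hdim hΦ hr (hT r)
  have hpos := one_sub_cosAngle_sq_pos hξ (hT p)
  have hu := mdifferentiableAt_cosAngle hf hξ hX (hT p)
  have hder : HasDerivAt (fun x : ℝ ↦ Real.sqrt (1 - x ^ 2))
      ((-(2 * cosAngle f ξ X p)) / (2 * Real.sqrt (1 - cosAngle f ξ X p ^ 2)))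
      (cosAngle f ξ X p) := by
    have := ((hasDerivAt_pow 2 (cosAngle f ξ X p)).const_sub 1).sqrt hpos.ne'
    simpa using this
  have h6 := (Real.sqrt_pos.2 hpos).ne'
  refine ⟨?_, fun v ↦ ?_⟩
  · refine MDifferentiableAt.congr_of_eventuallyEq ?_ heq
    exact MDifferentiableAt.comp p (g := fun x : ℝ ↦ Real.sqrt (1 - x ^ 2))
      hder.differentiableAt.mdifferentiableAt hu
  · rw [mvfderiv_congr heq, mvfderiv_comp_real (φ := fun x ↦ Real.sqrt (1 - x ^ 2)) hu hder]
    simp [hc, h6]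

end Height

section GradientLevels

variable {E : Type*} [NormedAddCommGroup E] [NormedSpace ℝ E] [FiniteDimensional ℝ E]
  {M : Type*} [TopologicalSpace M] [ChartedSpace E M] [IsManifold 𝓘(ℝ, E) ∞ M]
  [RiemannianBundle (fun x : M ↦ TangentSpace 𝓘(ℝ, E) x)]

theorem gradientNormConstantOnLevels_iff {g : M → ℝ} {S : Set M}
    (hS : IsOpen S) (hg : ∀ p ∈ S, ContMDiffAt 𝓘(ℝ, E) 𝓘(ℝ, ℝ) ∞ g p)
    (hd : ∀ p ∈ S, gradient 𝓘(ℝ, E) g p ≠ 0) :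
    GradientNormConstantOnLevels 𝓘(ℝ, E) g S ↔
      LocallyConstantOnLevels g (fun p ↦ ‖gradient 𝓘(ℝ, E) g p‖) S :=
  forall_connectedComponentIn_iff_locallyConstantOnLevels hS
    (fun p hp ↦ (hg p hp).of_le ENat.LEInfty.out) fun p hp ↦ mvfderiv_ne_zero_of_gradient (hd p hp)

end GradientLevels

section HeightLevels

variable {E : Type*} [NormedAddCommGroup E] [NormedSpace ℝ E] [FiniteDimensional ℝ E]
  {M : Type*} [TopologicalSpace M] [ChartedSpace E M] [IsManifold 𝓘(ℝ, E) ∞ M]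
  [RiemannianBundle (fun x : M ↦ TangentSpace 𝓘(ℝ, E) x)]
  [IsContMDiffRiemannianBundle 𝓘(ℝ, E) ∞ E (fun x : M ↦ TangentSpace 𝓘(ℝ, E) x)]
  {E' : Type*} [NormedAddCommGroup E'] [NormedSpace ℝ E'] [FiniteDimensional ℝ E']
  {H' : Type*} [TopologicalSpace H'] {I' : ModelWithCorners ℝ E' H'}
  {Q : Type*} [TopologicalSpace Q] [ChartedSpace H' Q] [IsManifold I' ∞ Q]
  [RiemannianBundle (fun x : Q ↦ TangentSpace I' x)]
  [IsContMDiffRiemannianBundle I' ∞ E' (fun x : Q ↦ TangentSpace I' x)]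
  {f : M → Q} {ξ : Π p : M, TangentSpace I' (f p)} {X : Π q : Q, TangentSpace I' q}
  {E₀ : Type*} [NormedAddCommGroup E₀] [NormedSpace ℝ E₀]
  {H₀ : Type*} [TopologicalSpace H₀] {I₀ : ModelWithCorners ℝ E₀ H₀}
  {N : Type*} [TopologicalSpace N] [ChartedSpace H₀ N]
  [RiemannianBundle (fun x : N ↦ TangentSpace I₀ x)]
  {J : Set ℝ} {ϱ : ℝ → ℝ} {Φ : OpenPartialHomeomorph Q (ℝ × N)}

theorem gradientNormConstantOnLevels_height_iff_locallyConstantOnLevels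
    (hf : IsIsometricImmersion 𝓘(ℝ, E) I' f) (hξ : IsUnitNormal 𝓘(ℝ, E) I' f ξ)
    (hdim : Module.finrank ℝ E' = Module.finrank ℝ E + 1)
    (hΦ : IsWarpedProductChart I₀ I' X J ϱ Φ) (hT : ∀ p, tangentPart I' f ξ X p ≠ 0) :
    GradientNormConstantOnLevels 𝓘(ℝ, E) (fun p ↦ (Φ (f p)).1) (f ⁻¹' Φ.source) ↔
      LocallyConstantOnLevels (fun p ↦ (Φ (f p)).1)
        (fun p ↦ ‖gradient 𝓘(ℝ, E) (fun p ↦ (Φ (f p)).1) p‖) (f ⁻¹' Φ.source) :=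
  gradientNormConstantOnLevels_iff (Φ.open_source.preimage hf.contMDiff.continuous)
    (fun _ hp ↦ contMDiffAt_height hf hΦ hp)
    fun p hp ↦ gradient_height_ne_zero hf hξ hdim hΦ hp (hT p)

theorem gradientNormConstantOnLevels_height_iff
    (hf : IsIsometricImmersion 𝓘(ℝ, E) I' f) (hξ : IsUnitNormal 𝓘(ℝ, E) I' f ξ)
    (hX : IsClosedConformal I' X)
    (hdim : Module.finrank ℝ E' = Module.finrank ℝ E + 1)
    (hΦ : IsWarpedProductChart I₀ I' X J ϱ Φ) (hT : ∀ p, tangentPart I' f ξ X p ≠ 0)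
    (hc : ∀ p ∈ f ⁻¹' Φ.source, cosAngle f ξ X p ≠ 0) :
    GradientNormConstantOnLevels 𝓘(ℝ, E) (fun p ↦ (Φ (f p)).1) (f ⁻¹' Φ.source) ↔
      ∀ p ∈ f ⁻¹' Φ.source, ∀ v : TangentSpace 𝓘(ℝ, E) p,
        inner ℝ v (fieldT 𝓘(ℝ, E) I' f ξ X p) = 0 →
        mvfderiv 𝓘(ℝ, E) (cosAngle f ξ X) p v = 0 := by
  rw [gradientNormConstantOnLevels_height_iff_locallyConstantOnLevels hf hξ hdim hΦ hT,
    locallyConstantOnLevels_iff_mvfderiv (Φ.open_source.preimage hf.contMDiff.continuous)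
      (fun p hp ↦ (contMDiffAt_height hf hΦ hp).of_le ENat.LEInfty.out)
      (fun p hp ↦ mvfderiv_ne_zero_of_gradient (gradient_height_ne_zero hf hξ hdim hΦ hp (hT p)))
      (fun p hp ↦ (mvfderiv_norm_gradient_height hf hξ hX hdim hΦ hp hT (hc p hp)).1)]
  refine forall₃_congr fun p hp v ↦ ?_
  rw [mvfderiv_height_eq_zero_iff hf hξ hΦ hp (hT p),
    (mvfderiv_norm_gradient_height hf hξ hX hdim hΦ hp hT (hc p hp)).2]

end HeightLevels

theorem map_nhds_eq_of_surjective_mfderiv {E : Type*} [NormedAddCommGroup E] [NormedSpace ℝ E]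
    [CompleteSpace E] {E' : Type*} [NormedAddCommGroup E'] [NormedSpace ℝ E'] [CompleteSpace E']
    {H : Type*} [TopologicalSpace H] {I : ModelWithCorners ℝ E H} [I.Boundaryless]
    {H' : Type*} [TopologicalSpace H'] {I' : ModelWithCorners ℝ E' H'} [I'.Boundaryless]
    {M : Type*} [TopologicalSpace M] [ChartedSpace H M]
    {N : Type*} [TopologicalSpace N] [ChartedSpace H' N] {g : M → N} {p : M}
    (hg : ContMDiffAt I I' 1 g p)
    (hs : Function.Surjective (mfderiv I I' g p)) :
    Filter.map g (𝓝 p) = 𝓝 (g p) := by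
  obtain ⟨hc, hG⟩ := contMDiffAt_iff.1 hg
  rw [I.range_eq_univ, contDiffWithinAt_univ] at hG
  set x := extChartAt I p p
  set G : E → E' := extChartAt I' (g p) ∘ g ∘ (extChartAt I p).symm
  have hfd : mfderiv I I' g p = fderiv ℝ G x := by
    rw [(hg.mdifferentiableAt (by simp)).mfderiv, I.range_eq_univ, fderivWithin_univ]
    rfl
  have hmap : Filter.map G (𝓝 x) = 𝓝 (G x) := by
    refine (hG.hasStrictFDerivAt (by simp)).map_nhds_eq_of_surj ?_
    exact LinearMap.range_eq_top.2 (hfd ▸ hs)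
  have hx : Filter.map (extChartAt I p).symm (𝓝 x) = 𝓝 p := by
    have := map_extChartAt_symm_nhdsWithin_range (I := I) p
    rwa [I.range_eq_univ, nhdsWithin_univ] at this
  have hGx : G x = extChartAt I' (g p) (g p) := by
    simp [G, x]
  have hy : Filter.map (extChartAt I' (g p)).symm (𝓝 (G x)) = 𝓝 (g p) := by
    have := map_extChartAt_symm_nhdsWithin_range (I := I') (g p)
    rwa [I'.range_eq_univ, nhdsWithin_univ, ← hGx] at this
  have heq : (extChartAt I' (g p)).symm ∘ extChartAt I' (g p) ∘ g =ᶠ[𝓝 p] g := by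
    filter_upwards [hc.eventually (extChartAt_source_mem_nhds (I := I') (g p))] with r hr
    exact (extChartAt I' (g p)).left_inv hr
  rw [← hy, ← hmap, ← Filter.map_congr heq, ← hx]
  simp only [Filter.map_map]
  rfl

section Graph

set_option linter.unusedSectionVars false

variable {E : Type*} [NormedAddCommGroup E] [NormedSpace ℝ E] [FiniteDimensional ℝ E]
  {M : Type*} [TopologicalSpace M] [ChartedSpace E M]
  [RiemannianBundle (fun x : M ↦ TangentSpace 𝓘(ℝ, E) x)]
  {E' : Type*} [NormedAddCommGroup E'] [NormedSpace ℝ E'] [FiniteDimensional ℝ E']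
  {H' : Type*} [TopologicalSpace H'] {I' : ModelWithCorners ℝ E' H'}
  {Q : Type*} [TopologicalSpace Q] [ChartedSpace H' Q]
  [RiemannianBundle (fun x : Q ↦ TangentSpace I' x)]
  {f : M → Q} {X : Π q : Q, TangentSpace I' q}
  {N : Type*} [TopologicalSpace N] [ChartedSpace E N]
  [RiemannianBundle (fun x : N ↦ TangentSpace 𝓘(ℝ, E) x)]
  {J : Set ℝ} {ϱ : ℝ → ℝ} {Φ : OpenPartialHomeomorph Q (ℝ × N)}

theorem contMDiffAt_base (hf : IsIsometricImmersion 𝓘(ℝ, E) I' f)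
    (hΦ : IsWarpedProductChart 𝓘(ℝ, E) I' X J ϱ Φ) {p : M} (hp : f p ∈ Φ.source) :
    ContMDiffAt 𝓘(ℝ, E) 𝓘(ℝ, E) ∞ (fun r ↦ (Φ (f r)).2) p :=
  contMDiffAt_snd.comp p ((hΦ.contMDiffAt hp).comp p hf.contMDiff.contMDiffAt)

theorem inner_eq_height_add_base (hf : IsIsometricImmersion 𝓘(ℝ, E) I' f)
    (hΦ : IsWarpedProductChart 𝓘(ℝ, E) I' X J ϱ Φ) {p : M} (hp : f p ∈ Φ.source)
    (v w : TangentSpace 𝓘(ℝ, E) p) :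
    inner ℝ v w = mvfderiv 𝓘(ℝ, E) (fun r ↦ (Φ (f r)).1) p v
        * mvfderiv 𝓘(ℝ, E) (fun r ↦ (Φ (f r)).1) p w
      + ϱ (Φ (f p)).1 ^ 2 * inner ℝ
        (mfderiv 𝓘(ℝ, E) 𝓘(ℝ, E) (fun r ↦ (Φ (f r)).2) p v)
        (mfderiv 𝓘(ℝ, E) 𝓘(ℝ, E) (fun r ↦ (Φ (f r)).2) p w) := by
  have hd := (hΦ.contMDiffAt hp).mdifferentiableAt (by simp)
  have hfd := hf.contMDiff.mdifferentiableAt (x := p) (by simp)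
  have hΦf := hd.comp p hfd
  have h1 : ∀ v, mvfderiv 𝓘(ℝ, E) (fun r ↦ (Φ (f r)).1) p v
      = (mfderiv I' (𝓘(ℝ, ℝ).prod 𝓘(ℝ, E)) Φ (f p) (mfderiv 𝓘(ℝ, E) I' f p v) :
        TangentSpace (𝓘(ℝ, ℝ).prod 𝓘(ℝ, E)) (Φ (f p))).1 := by
    intro v
    have h := mfderiv_comp_apply (I' := 𝓘(ℝ, ℝ).prod 𝓘(ℝ, E)) (I'' := 𝓘(ℝ, ℝ)) p
      (g := Prod.fst) (f := Φ ∘ f) mdifferentiableAt_fst hΦf v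
    rw [mfderiv_comp_apply p hd hfd, mfderiv_fst] at h
    exact h
  have h2 : ∀ v, mfderiv 𝓘(ℝ, E) 𝓘(ℝ, E) (fun r ↦ (Φ (f r)).2) p v
      = (mfderiv I' (𝓘(ℝ, ℝ).prod 𝓘(ℝ, E)) Φ (f p) (mfderiv 𝓘(ℝ, E) I' f p v) :
        TangentSpace (𝓘(ℝ, ℝ).prod 𝓘(ℝ, E)) (Φ (f p))).2 := by
    intro v
    have h := mfderiv_comp_apply (I' := 𝓘(ℝ, ℝ).prod 𝓘(ℝ, E)) (I'' := 𝓘(ℝ, E)) p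
      (g := Prod.snd) (f := Φ ∘ f) mdifferentiableAt_snd hΦf v
    rw [mfderiv_comp_apply p hd hfd, mfderiv_snd] at h
    exact h
  rw [← hf.inner_mfderiv, hΦ.inner_eq _ hp, h1, h1, h2, h2]
  rfl

variable {F : N → ℝ} {U : Set N}

theorem mem_and_height_eq_of_graph
    (hgr : Φ '' (f '' (f ⁻¹' Φ.source)) = {y : ℝ × N | y.2 ∈ U ∧ y.1 = F y.2}) {p : M}
    (hp : f p ∈ Φ.source) : (Φ (f p)).2 ∈ U ∧ (Φ (f p)).1 = F (Φ (f p)).2 :=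
  hgr.subset (mem_image_of_mem _ (mem_image_of_mem _ hp))

theorem exists_base_eq_of_graph
    (hgr : Φ '' (f '' (f ⁻¹' Φ.source)) = {y : ℝ × N | y.2 ∈ U ∧ y.1 = F y.2}) {x : N}
    (hx : x ∈ U) : ∃ p, f p ∈ Φ.source ∧ (Φ (f p)).2 = x := by
  obtain ⟨_, ⟨p, hp, rfl⟩, h⟩ := hgr.superset (show (F x, x) ∈ _ from ⟨hx, rfl⟩)
  exact ⟨p, hp, by rw [h]⟩

theorem mvfderiv_height_of_graph (hf : IsIsometricImmersion 𝓘(ℝ, E) I' f)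
    (hΦ : IsWarpedProductChart 𝓘(ℝ, E) I' X J ϱ Φ) {p : M} (hp : f p ∈ Φ.source)
    (hF : ∀ x ∈ U, ContMDiffAt 𝓘(ℝ, E) 𝓘(ℝ, ℝ) ∞ F x)
    (hgr : Φ '' (f '' (f ⁻¹' Φ.source)) = {y : ℝ × N | y.2 ∈ U ∧ y.1 = F y.2})
    (v : TangentSpace 𝓘(ℝ, E) p) :
    mvfderiv 𝓘(ℝ, E) (fun r ↦ (Φ (f r)).1) p v
      = mvfderiv 𝓘(ℝ, E) F (Φ (f p)).2
        (mfderiv 𝓘(ℝ, E) 𝓘(ℝ, E) (fun r ↦ (Φ (f r)).2) p v) := by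
  have heq : (fun r ↦ (Φ (f r)).1) =ᶠ[𝓝 p] fun r ↦ F (Φ (f r)).2 := by
    filter_upwards [hf.contMDiff.continuous.continuousAt.eventually (Φ.open_source.mem_nhds hp)]
      with r hr
    exact (mem_and_height_eq_of_graph hgr hr).2
  rw [mvfderiv_congr heq]
  exact mfderiv_comp_apply p (g := F) (f := fun r ↦ (Φ (f r)).2)
    ((hF _ (mem_and_height_eq_of_graph hgr hp).1).mdifferentiableAt (by simp))
    ((contMDiffAt_base hf hΦ hp).mdifferentiableAt (by simp)) v

theorem surjective_mfderiv_base_of_graph (hf : IsIsometricImmersion 𝓘(ℝ, E) I' f)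
    (hΦ : IsWarpedProductChart 𝓘(ℝ, E) I' X J ϱ Φ) {p : M} (hp : f p ∈ Φ.source)
    (hF : ∀ x ∈ U, ContMDiffAt 𝓘(ℝ, E) 𝓘(ℝ, ℝ) ∞ F x)
    (hgr : Φ '' (f '' (f ⁻¹' Φ.source)) = {y : ℝ × N | y.2 ∈ U ∧ y.1 = F y.2}) :
    Function.Surjective (mfderiv 𝓘(ℝ, E) 𝓘(ℝ, E) (fun r ↦ (Φ (f r)).2) p) := by
  let L : E →L[ℝ] E := mfderiv 𝓘(ℝ, E) 𝓘(ℝ, E) (fun r ↦ (Φ (f r)).2) p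
  have hinj : Function.Injective L.toLinearMap := by
    rw [injective_iff_map_eq_zero]
    intro (v : TangentSpace 𝓘(ℝ, E) p) hv
    have hv' : mfderiv 𝓘(ℝ, E) 𝓘(ℝ, E) (fun r ↦ (Φ (f r)).2) p v = 0 := hv
    have h0 := mvfderiv_height_of_graph hf hΦ hp hF hgr v
    have h := inner_eq_height_add_base hf hΦ hp v v
    rw [hv', map_zero] at h0
    rw [h0, hv', inner_zero_right, mul_zero, mul_zero, zero_add] at h
    exact (inner_self_eq_zero (𝕜 := ℝ) (E := TangentSpace 𝓘(ℝ, E) p)).1 h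
  exact LinearMap.injective_iff_surjective.1 hinj

/-- The gradients of the height function `h` and of `F` satisfy
`|∇F|² = (|∇F|² + ϱ(h)²) |∇h|²`. -/
theorem sq_norm_gradient_eq_of_graph (hf : IsIsometricImmersion 𝓘(ℝ, E) I' f)
    (hΦ : IsWarpedProductChart 𝓘(ℝ, E) I' X J ϱ Φ) {p : M} (hp : f p ∈ Φ.source)
    (hF : ∀ x ∈ U, ContMDiffAt 𝓘(ℝ, E) 𝓘(ℝ, ℝ) ∞ F x)
    (hgr : Φ '' (f '' (f ⁻¹' Φ.source)) = {y : ℝ × N | y.2 ∈ U ∧ y.1 = F y.2}) :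
    ‖gradient 𝓘(ℝ, E) F (Φ (f p)).2‖ ^ 2
      = (‖gradient 𝓘(ℝ, E) F (Φ (f p)).2‖ ^ 2 + ϱ (Φ (f p)).1 ^ 2)
        * ‖gradient 𝓘(ℝ, E) (fun r ↦ (Φ (f r)).1) p‖ ^ 2 := by
  set Z := gradient 𝓘(ℝ, E) F (Φ (f p)).2 with hZ
  obtain ⟨w, hw⟩ := surjective_mfderiv_base_of_graph hf hΦ hp hF hgr Z
  have hdF : ∀ v, mvfderiv 𝓘(ℝ, E) (fun r ↦ (Φ (f r)).1) p v
      = inner ℝ Z (mfderiv 𝓘(ℝ, E) 𝓘(ℝ, E) (fun r ↦ (Φ (f r)).2) p v) := fun v ↦ by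
    rw [mvfderiv_height_of_graph hf hΦ hp hF hgr]
    exact (inner_gradient F _ _).symm
  have hdw : mvfderiv 𝓘(ℝ, E) (fun r ↦ (Φ (f r)).1) p w = ‖Z‖ ^ 2 := by
    rw [hdF, hw]
    exact real_inner_self_eq_norm_sq Z
  have hgrad : w = (‖Z‖ ^ 2 + ϱ (Φ (f p)).1 ^ 2) • gradient 𝓘(ℝ, E) (fun r ↦ (Φ (f r)).1) p := by
    refine ext_inner_right ℝ fun v ↦ ?_
    rw [inner_eq_height_add_base hf hΦ hp, inner_smul_left, inner_gradient, hdw, hw, conj_trivial,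
      add_mul, ← hdF]
  have h := inner_gradient (I := 𝓘(ℝ, E)) (fun r ↦ (Φ (f r)).1) p w
  rw [hdw, hgrad, inner_smul_right, real_inner_self_eq_norm_sq] at h
  exact h.symm

theorem locallyConstantOnLevels_graph_iff (hf : IsIsometricImmersion 𝓘(ℝ, E) I' f)
    (hΦ : IsWarpedProductChart 𝓘(ℝ, E) I' X J ϱ Φ)
    (hF : ∀ x ∈ U, ContMDiffAt 𝓘(ℝ, E) 𝓘(ℝ, ℝ) ∞ F x)
    (hgr : Φ '' (f '' (f ⁻¹' Φ.source)) = {y : ℝ × N | y.2 ∈ U ∧ y.1 = F y.2}) :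
    LocallyConstantOnLevels (fun p ↦ (Φ (f p)).1)
        (fun p ↦ ‖gradient 𝓘(ℝ, E) (fun p ↦ (Φ (f p)).1) p‖) (f ⁻¹' Φ.source) ↔
      LocallyConstantOnLevels F (fun x ↦ ‖gradient 𝓘(ℝ, E) F x‖) U := by
  have key : ∀ p ∈ f ⁻¹' Φ.source, ∀ q ∈ f ⁻¹' Φ.source, (Φ (f q)).1 = (Φ (f p)).1 →
      (‖gradient 𝓘(ℝ, E) (fun p ↦ (Φ (f p)).1) q‖ = ‖gradient 𝓘(ℝ, E) (fun p ↦ (Φ (f p)).1) p‖ ↔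
        ‖gradient 𝓘(ℝ, E) F (Φ (f q)).2‖ = ‖gradient 𝓘(ℝ, E) F (Φ (f p)).2‖) := by
    intro p hp q hq hpq
    have h1 := sq_norm_gradient_eq_of_graph hf hΦ hp hF hgr
    have h2 := sq_norm_gradient_eq_of_graph hf hΦ hq hF hgr
    have hϱ : 0 < ϱ (Φ (f p)).1 ^ 2 := pow_pos (hΦ.warping_pos _ (hΦ.mem_interval hp)) 2
    rw [hpq] at h2
    rw [← sq_eq_sq₀ (norm_nonneg _) (norm_nonneg _),
      ← sq_eq_sq₀ (norm_nonneg (gradient 𝓘(ℝ, E) F (Φ (f q)).2)) (norm_nonneg _)]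
    generalize ‖gradient 𝓘(ℝ, E) F (Φ (f q)).2‖ ^ 2 = a' at *
    generalize hb : ‖gradient 𝓘(ℝ, E) F (Φ (f p)).2‖ ^ 2 = a at *
    have ha : 0 ≤ a := hb ▸ sq_nonneg _
    generalize ‖gradient 𝓘(ℝ, E) (fun p ↦ (Φ (f p)).1) q‖ ^ 2 = k' at *
    generalize ‖gradient 𝓘(ℝ, E) (fun p ↦ (Φ (f p)).1) p‖ ^ 2 = k at *
    generalize ϱ (Φ (f p)).1 ^ 2 = s at *
    constructor
    · rintro rfl
      have : s * (a' - a) = 0 := by linear_combination (a + s) * h2 - (a' + s) * h1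
      rcases mul_eq_zero.1 this with h | h
      · exact absurd h hϱ.ne'
      · exact sub_eq_zero.1 h
    · rintro rfl
      have : (a' + s) * (k' - k) = 0 := by linear_combination h1 - h2
      rcases mul_eq_zero.1 this with h | h
      · linarith
      · exact sub_eq_zero.1 h
  have hloc : ∀ p ∈ f ⁻¹' Φ.source,
      ((∀ᶠ q in 𝓝 p, (Φ (f q)).1 = (Φ (f p)).1 →
        ‖gradient 𝓘(ℝ, E) (fun p ↦ (Φ (f p)).1) q‖ = ‖gradient 𝓘(ℝ, E) (fun p ↦ (Φ (f p)).1) p‖) ↔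
      ∀ᶠ y in 𝓝 (Φ (f p)).2, F y = F (Φ (f p)).2 →
        ‖gradient 𝓘(ℝ, E) F y‖ = ‖gradient 𝓘(ℝ, E) F (Φ (f p)).2‖) := by
    intro p hp
    rw [← map_nhds_eq_of_surjective_mfderiv
      ((contMDiffAt_base hf hΦ hp).of_le ENat.LEInfty.out)
      (surjective_mfderiv_base_of_graph hf hΦ hp hF hgr), Filter.eventually_map]
    refine Filter.eventually_congr ?_
    filter_upwards [hf.contMDiff.continuous.continuousAt.eventually (Φ.open_source.mem_nhds hp)]
      with q hq
    rw [← (mem_and_height_eq_of_graph hgr hp).2, ← (mem_and_height_eq_of_graph hgr hq).2]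
    exact forall_congr' fun hpq ↦ key p hp q hq hpq
  constructor
  · intro h x hx
    obtain ⟨p, hp, rfl⟩ := exists_base_eq_of_graph hgr hx
    exact (hloc p hp).1 (h p hp)
  · intro h p hp
    exact (hloc p hp).2 (h _ (mem_and_height_eq_of_graph hgr hp).1)

end Graph

section GraphLevels

variable {E : Type*} [NormedAddCommGroup E] [NormedSpace ℝ E] [FiniteDimensional ℝ E]
  {M : Type*} [TopologicalSpace M] [ChartedSpace E M] [IsManifold 𝓘(ℝ, E) ∞ M]
  [RiemannianBundle (fun x : M ↦ TangentSpace 𝓘(ℝ, E) x)]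
  [IsContMDiffRiemannianBundle 𝓘(ℝ, E) ∞ E (fun x : M ↦ TangentSpace 𝓘(ℝ, E) x)]
  {E' : Type*} [NormedAddCommGroup E'] [NormedSpace ℝ E'] [FiniteDimensional ℝ E']
  {H' : Type*} [TopologicalSpace H'] {I' : ModelWithCorners ℝ E' H'}
  {Q : Type*} [TopologicalSpace Q] [ChartedSpace H' Q] [IsManifold I' ∞ Q]
  [RiemannianBundle (fun x : Q ↦ TangentSpace I' x)]
  [IsContMDiffRiemannianBundle I' ∞ E' (fun x : Q ↦ TangentSpace I' x)]
  {f : M → Q} {ξ : Π p : M, TangentSpace I' (f p)} {X : Π q : Q, TangentSpace I' q}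
  {N : Type*} [TopologicalSpace N] [ChartedSpace E N] [IsManifold 𝓘(ℝ, E) ∞ N]
  [RiemannianBundle (fun x : N ↦ TangentSpace 𝓘(ℝ, E) x)]
  {J : Set ℝ} {ϱ : ℝ → ℝ} {Φ : OpenPartialHomeomorph Q (ℝ × N)} {F : N → ℝ} {U : Set N}

theorem gradientNormConstantOnLevels_height_iff_graph
    (hf : IsIsometricImmersion 𝓘(ℝ, E) I' f) (hξ : IsUnitNormal 𝓘(ℝ, E) I' f ξ)
    (hdim : Module.finrank ℝ E' = Module.finrank ℝ E + 1)
    (hΦ : IsWarpedProductChart 𝓘(ℝ, E) I' X J ϱ Φ) (hT : ∀ p, tangentPart I' f ξ X p ≠ 0)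
    (hU : IsOpen U) (hF : ContMDiffOn 𝓘(ℝ, E) 𝓘(ℝ, ℝ) ∞ F U)
    (hgr : Φ '' (f '' (f ⁻¹' Φ.source)) = {y : ℝ × N | y.2 ∈ U ∧ y.1 = F y.2}) :
    GradientNormConstantOnLevels 𝓘(ℝ, E) (fun p ↦ (Φ (f p)).1) (f ⁻¹' Φ.source) ↔
      GradientNormConstantOnLevels 𝓘(ℝ, E) F U := by
  have hF' : ∀ x ∈ U, ContMDiffAt 𝓘(ℝ, E) 𝓘(ℝ, ℝ) ∞ F x := fun x hx ↦
    hF.contMDiffAt (hU.mem_nhds hx)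
  rw [gradientNormConstantOnLevels_height_iff_locallyConstantOnLevels hf hξ hdim hΦ hT,
    locallyConstantOnLevels_graph_iff hf hΦ hF' hgr, gradientNormConstantOnLevels_iff hU hF']
  intro x hx h0
  obtain ⟨p, hp, rfl⟩ := exists_base_eq_of_graph hgr hx
  have h := sq_norm_gradient_eq_of_graph hf hΦ hp hF' hgr
  have hk := norm_ne_zero_iff.2 (gradient_height_ne_zero hf hξ hdim hΦ hp (hT p))
  have hϱ := (hΦ.warping_pos _ (hΦ.mem_interval hp)).ne'
  rw [h0] at h
  simp [hϱ] at h
  exact gradient_height_ne_zero hf hξ hdim hΦ hp (hT p) h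

end GraphLevels

end Hypersurface

end

theorem mainTheorem1 {n : ℕ}
    -- the ambient Riemannian manifold
    {Q : Type*} [TopologicalSpace Q] [ChartedSpace (EuclideanSpace ℝ (Fin (n + 1))) Q]
    [IsManifold (𝓡 (n + 1)) ∞ Q]
    [RiemannianBundle (fun q : Q ↦ TangentSpace (𝓡 (n + 1)) q)]
    [IsContMDiffRiemannianBundle (𝓡 (n + 1)) ∞ (EuclideanSpace ℝ (Fin (n + 1)))
      (fun q : Q ↦ TangentSpace (𝓡 (n + 1)) q)]
    -- the hypersurface, with its induced metric
    {M : Type*} [TopologicalSpace M] [ChartedSpace (EuclideanSpace ℝ (Fin n)) M]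
    [IsManifold (𝓡 n) ∞ M]
    [RiemannianBundle (fun p : M ↦ TangentSpace (𝓡 n) p)]
    [IsContMDiffRiemannianBundle (𝓡 n) ∞ (EuclideanSpace ℝ (Fin n))
      (fun p : M ↦ TangentSpace (𝓡 n) p)]
    (f : M → Q) (hf : Hypersurface.IsIsometricImmersion (𝓡 n) (𝓡 (n + 1)) f)
    (ξ : Π p : M, TangentSpace (𝓡 (n + 1)) (f p))
    (hξ : Hypersurface.IsUnitNormal (𝓡 n) (𝓡 (n + 1)) f ξ)
    -- the closed conformal field
    (X : Π q : Q, TangentSpace (𝓡 (n + 1)) q) (hX : X ≠ 0)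
    (hXc : Hypersurface.IsClosedConformal (𝓡 (n + 1)) X)
    (hXT : ∀ p, Hypersurface.tangentPart (𝓡 (n + 1)) f ξ X p ≠ 0) :
    (Hypersurface.HasCanonicalPrincipalDirection (𝓡 n) (𝓡 (n + 1)) f ξ X univ ↔
      Hypersurface.AngleConstantOrthogonally (𝓡 n) (𝓡 (n + 1)) f ξ X univ) ∧
    ∀ (N : Type*) [TopologicalSpace N] [ChartedSpace (EuclideanSpace ℝ (Fin n)) N]
      [IsManifold (𝓡 n) ∞ N]
      [RiemannianBundle (fun x : N ↦ TangentSpace (𝓡 n) x)]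
      [IsContMDiffRiemannianBundle (𝓡 n) ∞ (EuclideanSpace ℝ (Fin n))
        (fun x : N ↦ TangentSpace (𝓡 n) x)]
      (J : Set ℝ) (ϱ : ℝ → ℝ) (Φ : OpenPartialHomeomorph Q (ℝ × N)),
      Hypersurface.IsWarpedProductChart (𝓡 n) (𝓡 (n + 1)) X J ϱ Φ →
      (∀ p ∈ f ⁻¹' Φ.source, Hypersurface.angleXi (𝓡 (n + 1)) f ξ X p ≠ Real.pi / 2) →
      List.TFAE
        [Hypersurface.HasCanonicalPrincipalDirection (𝓡 n) (𝓡 (n + 1)) f ξ X (f ⁻¹' Φ.source),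
          Hypersurface.AngleConstantOrthogonally (𝓡 n) (𝓡 (n + 1)) f ξ X (f ⁻¹' Φ.source),
          Hypersurface.IntegralCurvesAreGeodesics (𝓡 n)
            (Hypersurface.fieldT (𝓡 n) (𝓡 (n + 1)) f ξ X) (f ⁻¹' Φ.source),
          Hypersurface.GradientNormConstantOnLevels (𝓡 n)
            (fun p ↦ (Φ (f p)).1) (f ⁻¹' Φ.source)] ∧
      ∀ (U : Set N) (F : N → ℝ), IsOpen U → ContMDiffOn (𝓡 n) 𝓘(ℝ, ℝ) ∞ F U → MapsTo F U J →
        Φ '' (f '' (f ⁻¹' Φ.source)) = {y : ℝ × N | y.2 ∈ U ∧ y.1 = F y.2} →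
        (Hypersurface.HasCanonicalPrincipalDirection (𝓡 n) (𝓡 (n + 1)) f ξ X (f ⁻¹' Φ.source) ↔
          Hypersurface.GradientNormConstantOnLevels (𝓡 n) F U) := by
  have hdim : Module.finrank ℝ (EuclideanSpace ℝ (Fin (n + 1)))
      = Module.finrank ℝ (EuclideanSpace ℝ (Fin n)) + 1 := by simp
  have h12 : ∀ S : Set M,
      Hypersurface.HasCanonicalPrincipalDirection (𝓡 n) (𝓡 (n + 1)) f ξ X S ↔
        Hypersurface.AngleConstantOrthogonally (𝓡 n) (𝓡 (n + 1)) f ξ X S := fun S ↦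
    (Hypersurface.hasCanonicalPrincipalDirection_iff hf hξ hXc hdim hXT S).trans
      (Hypersurface.angleConstantOrthogonally_iff hf hξ hXc hXT S).symm
  refine ⟨h12 univ, ?_⟩
  intro N _ _ _ _ _ J ϱ Φ hΦ hθ
  have hc : ∀ p ∈ f ⁻¹' Φ.source, Hypersurface.cosAngle f ξ X p ≠ 0 := fun p hp ↦
    Hypersurface.cosAngle_ne_zero hξ (hθ p hp)
  have h14 := (Hypersurface.hasCanonicalPrincipalDirection_iff hf hξ hXc hdim hXT
    (f ⁻¹' Φ.source)).trans
    (Hypersurface.gradientNormConstantOnLevels_height_iff hf hξ hXc hdim hΦ hXT hc).symm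
  have h13 := (Hypersurface.hasCanonicalPrincipalDirection_iff hf hξ hXc hdim hXT
    (f ⁻¹' Φ.source)).trans
    ((Hypersurface.integralCurvesAreGeodesics_iff
      (Φ.open_source.preimage hf.contMDiff.continuous)
      (fun p _ ↦ Hypersurface.contMDiffAt_fieldT hf hξ hXc (hXT p))).trans
      (forall₂_congr fun p hp ↦
        Hypersurface.leviCivita_fieldT_fieldT_eq_zero_iff hf hξ hXc hdim hXT (hc p hp))).symm
  constructor
  · tfae_have 1 ↔ 2 := h12 _
    tfae_have 1 ↔ 3 := h13
    tfae_have 1 ↔ 4 := h14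
    tfae_finish
  · intro U F hU hF _ hgr
    exact h14.trans
      (Hypersurface.gradientNormConstantOnLevels_height_iff_graph hf hξ hdim hΦ hXT hU hF hgr)
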